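/- Let $\mathfrak g=\mathfrak g_{\bar 0}\oplus\mathfrak g_{\bar 1}$ be a finite-dimensional complex quadratic Lie superalgebra, i.e. a Lie superalgebra with a fixed non-degenerate bilinear form $B$ that is invariant ($B([x,y],z)=B(x,[y,z])$), supersymmetric ($B(x,y)=(-1)^{p(x)p(y)}B(y,x)$ for homogeneous $x,y$) and consistent ($B(\mathfrak g_{\bar 0},\mathfrak g_{\bar 1})=0=B(\mathfrak g_{\bar 1},\mathfrak g_{\bar 0})$). Let $\mathfrak U(\mathfrak g)$ be its universal enveloping algebra and let $\mathrm{Cl}(\mathfrak g)$ be its Clifford algebra, the quotient of the tensor algebra by the relations $xy+(-1)^{p(x)p(y)}yx=2B(x,y)$ for homogeneous $x,y\in\mathfrak g$. Both carry the $\mathbb Z_2$-grading induced by the parity of $\mathfrak g$, and $\mathcal W(\mathfrak g)=\mathfrak U(\mathfrak g)\otimes\mathrm{Cl}(\mathfrak g)$ is the graded tensor product, with $(u\otimes c)(u'\otimes c')=(-1)^{p(c)p(u')}uu'\otimes cc'$. Let $\{e_a\}$ be any homogeneous basis of $\mathfrak g$ and $\{e^a\}$ its $B$-dual basis, $B(e_a,e^b)=\delta_{ab}$;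 write $p_a=p(e_a)$ and $f_{abc}=B([e_a,e_b],e_c)$. Let $$\Omega_{\mathfrak g}=\sum_a e^ae_a\in\mathfrak U(\mathfrak g),\qquad \phi'=-\frac1{12}\sum_{a,b,c}(-1)^{p_ap_b+p_c}f_{abc}\,q(e^a\wedge e^b\wedge e^c)\in\mathrm{Cl}(\mathfrak g),$$ where for homogeneous $x_1,x_2,x_3$ $$q(x_1\wedge x_2\wedge x_3)=\frac1{3!}\sum_{\sigma\in S_3}p(\sigma;x_1,x_2,x_3)\,x_{\sigma(1)}x_{\sigma(2)}x_{\sigma(3)},\qquad p(\sigma;x_1,x_2,x_3)=\operatorname{sgn}(\sigma)\prod_{i<j,\ \sigma^{-1}(i)>\sigma^{-1}(j)}(-1)^{p(x_i)p(x_j)}.$$ The cubic Dirac operator is $\mathrm D_{\mathfrak g}=\sum_a e^a\otimes e_a+1\otimes\phi'\in\mathcal W(\mathfrak g)$. **Theorem.** One has $$\mathrm D_{\mathfrak g}^2=\Omega_{\mathfrak g}\otimes1+\tfrac1{24}\operatorname{str}_{\mathfrak g}\bigl(\operatorname{ad}_{\mathfrak g}(\Omega_{\mathfrak g})\bigr)(1\otimes1),$$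 where $\operatorname{ad}_{\mathfrak g}:\mathfrak U(\mathfrak g)\to\operatorname{End}(\mathfrak g)$ extends the adjoint representation and $\operatorname{str}_{\mathfrak g}$ is the supertrace on $\mathfrak g$. Suppose moreover that $\mathfrak g$ is basic classical, i.e. $\mathfrak g$ is simple and the Lie algebra $\mathfrak g_{\bar 0}$ is reductive. Let $\mathfrak h\subset\mathfrak g_{\bar 0}$ be a Cartan subalgebra (an abelian subalgebra that equals its own centralizer in $\mathfrak g_{\bar 0}$ and whose elements act semisimply on $\mathfrak g$), let $\mathfrak g^\alpha=\{x\in\mathfrak g:[H,x]=\alpha(H)x\ \text{for all }H\in\mathfrak h\}$ for $\alpha\in\mathfrak h^*$, and let $\Delta=\{\alpha\neq0:\mathfrak g^\alpha\neq0\}$. Let $\Delta^+$ be a positive system, i.e. a subset of $\Delta$ that contains exactly one of $\alpha,-\alpha$ for each $\alpha\in\Delta$ and contains $\alpha+\beta$ whenever $\alpha,\beta\in\Delta^+$ and $\alpha+\beta\in\Delta$. Let $\rho=\rho_{\bar 0}-\rho_{\bar 1}$ be its Weyl vector, where $\rho_{\bar i}=\frac12\sum_{\alpha\in\Delta^+}\dim(\mathfrak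 g^\alpha\cap\mathfrak g_{\bar i})\,\alpha$. Then the restriction of $B$ to $\mathfrak h$ is non-degenerate, and, for the form induced by $B$ on $\mathfrak h^*$, $$\mathrm D_{\mathfrak g}^2=\Omega_{\mathfrak g}\otimes1+B(\rho,\rho)\,(1\otimes1).$$ -/

import Mathlib

open scoped TensorProduct Nat

noncomputable section

/-! ### Gradings by a parity automorphism -/

section ParityGrading

variable {A : Type*} [Ring A] [Algebra ℂ A]

/-- The `ℤ/2`-grading of a complex algebra attached to an algebra endomorphism `s`: an element `a`
has parity `i` when `s a = (-1) ^ i a`. -/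
def parityGrading (s : A →ₐ[ℂ] A) (i : ZMod 2) : Submodule ℂ A where
  carrier := {a | s a = ((-1 : ℤˣ) ^ i) • a}
  add_mem' := by
    intro a b ha hb
    simp only [Set.mem_ofPred_eq] at ha hb ⊢
    rw [map_add, ha, hb, smul_add]
  zero_mem' := by simp
  smul_mem' := by
    intro c a ha
    simp only [Set.mem_ofPred_eq] at ha ⊢
    rw [map_smul, ha, smul_comm]

theorem mem_parityGrading {s : A →ₐ[ℂ] A} {i : ZMod 2} {a : A} :
    a ∈ parityGrading s i ↔ s a = ((-1 : ℤˣ) ^ i) • a := Iff.rfl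

theorem mem_parityGrading_zero {s : A →ₐ[ℂ] A} {a : A} :
    a ∈ parityGrading s 0 ↔ s a = a := by
  rw [mem_parityGrading, uzpow_zero, one_smul]

theorem mem_parityGrading_one {s : A →ₐ[ℂ] A} {a : A} :
    a ∈ parityGrading s 1 ↔ s a = -a := by
  rw [mem_parityGrading, uzpow_one, Units.neg_smul, one_smul]

theorem half_add_half (a : A) : (1 / 2 : ℂ) • a + (1 / 2 : ℂ) • a = a := by
  rw [← add_smul]; norm_num

/-- The projection onto the elements of parity `i`. -/
def parityProj (s : A →ₐ[ℂ] A) (hs : ∀ a, s (s a) = a) (i : ZMod 2) :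
    A →ₗ[ℂ] parityGrading s i :=
  LinearMap.codRestrict (parityGrading s i)
    ((1 / 2 : ℂ) • (LinearMap.id + ((-1 : ℤˣ) ^ i) • s.toLinearMap)) (by
      intro a
      rw [mem_parityGrading]
      simp only [LinearMap.smul_apply, LinearMap.add_apply, LinearMap.id_apply,
        AlgHom.toLinearMap_apply, map_smul, map_add, Units.smul_def, map_zsmul, hs]
      simp only [← Units.smul_def]
      rw [smul_comm ((-1 : ℤˣ) ^ i), smul_add ((-1 : ℤˣ) ^ i), smul_smul, Int.units_mul_self,
        one_smul, add_comm])

theorem coe_parityProj (s : A →ₐ[ℂ] A) (hs : ∀ a, s (s a) = a) (i : ZMod 2) (a : A) :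
    (parityProj s hs i a : A) = (1 / 2 : ℂ) • (a + ((-1 : ℤˣ) ^ i) • s a) := rfl

theorem zmod_two_cases (i : ZMod 2) : i = 0 ∨ i = 1 := by
  revert i; decide

instance parityGrading_gradedMonoid (s : A →ₐ[ℂ] A) :
    SetLike.GradedMonoid (parityGrading s) where
  one_mem := by rw [mem_parityGrading_zero, map_one]
  mul_mem := by
    intro i j a b ha hb
    rw [mem_parityGrading] at ha hb ⊢
    rw [map_mul, ha, hb, uzpow_add, smul_mul_smul_comm]

/-- The algebra grading defined by an involutive algebra endomorphism. -/
abbrev parityGradedAlgebra (s : A →ₐ[ℂ] A) (hs : ∀ a, s (s a) = a) :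
    GradedAlgebra (parityGrading s) where
  toDecomposition := DirectSum.Decomposition.ofLinearMap (parityGrading s)
    (DirectSum.lof ℂ (ZMod 2) (fun i => parityGrading s i) 0 ∘ₗ parityProj s hs 0 +
      DirectSum.lof ℂ (ZMod 2) (fun i => parityGrading s i) 1 ∘ₗ parityProj s hs 1)
    (by
      ext a
      simp only [LinearMap.comp_apply, LinearMap.add_apply, map_add,
        DirectSum.coeLinearMap_lof, coe_parityProj, uzpow_zero, one_smul, uzpow_one,
        Units.neg_smul, smul_add, smul_neg, LinearMap.id_apply]
      rw [add_add_add_comm, add_neg_cancel, add_zero]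
      exact half_add_half a)
    (by
      ext i ⟨a, ha⟩ : 2
      simp only [LinearMap.comp_apply, LinearMap.add_apply, DirectSum.coeLinearMap_lof,
        LinearMap.id_apply]
      rcases zmod_two_cases i with rfl | rfl
      · have h0 : parityProj s hs 0 a = ⟨a, ha⟩ := by
          ext
          rw [coe_parityProj, mem_parityGrading_zero.1 ha, uzpow_zero, one_smul, smul_add]
          exact half_add_half a
        have h1 : parityProj s hs 1 a = 0 := by
          ext
          rw [coe_parityProj, mem_parityGrading_zero.1 ha, uzpow_one, Units.neg_smul, one_smul,
            add_neg_cancel, smul_zero]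
          rfl
        rw [h0, h1, map_zero, add_zero]
      · have h0 : parityProj s hs 0 a = 0 := by
          ext
          rw [coe_parityProj, mem_parityGrading_one.1 ha, uzpow_zero, one_smul,
            add_neg_cancel, smul_zero]
          rfl
        have h1 : parityProj s hs 1 a = ⟨a, ha⟩ := by
          ext
          rw [coe_parityProj, mem_parityGrading_one.1 ha, uzpow_one, Units.neg_smul, one_smul,
            neg_neg, smul_add]
          exact half_add_half a
        rw [h0, h1, map_zero, zero_add])

end ParityGrading

/-! ### Lie superalgebras -/

/-- A complex Lie superalgebra structure on the vector space `g`; `part 0` and `part 1` are its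
even and odd parts. -/
structure LieSuperalgebra (g : Type*) [AddCommGroup g] [Module ℂ g] where
  part : ZMod 2 → Submodule ℂ g
  isCompl : IsCompl (part 0) (part 1)
  bracket : g →ₗ[ℂ] g →ₗ[ℂ] g
  bracket_mem : ∀ {i j : ZMod 2} {x y : g}, x ∈ part i → y ∈ part j → bracket x y ∈ part (i + j)
  skew : ∀ {i j : ZMod 2} {x y : g}, x ∈ part i → y ∈ part j →
    bracket x y = -(((-1 : ℤˣ) ^ (i * j)) • bracket y x)
  jacobi : ∀ {i j : ZMod 2} {x y : g}, x ∈ part i → y ∈ part j → ∀ z : g,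
    bracket x (bracket y z) =
      bracket (bracket x y) z + ((-1 : ℤˣ) ^ (i * j)) • bracket y (bracket x z)

namespace LieSuperalgebra

variable {g : Type*} [AddCommGroup g] [Module ℂ g] (L : LieSuperalgebra g)

/-- The projection onto the part of parity `i` along the other part. -/
def proj (i : ZMod 2) : g →ₗ[ℂ] g :=
  if i = 0 then Submodule.projection (L.part 0) (L.part 1) L.isCompl
  else Submodule.projection (L.part 1) (L.part 0) L.isCompl.symm

/-- The parity involution of `g`: `x ↦ x` on even and `x ↦ -x` on odd elements. -/
def parity : g →ₗ[ℂ] g := L.proj 0 - L.proj 1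

theorem parity_of_mem {i : ZMod 2} {x : g} (hx : x ∈ L.part i) :
    L.parity x = ((-1 : ℤˣ) ^ i) • x := by
  rcases zmod_two_cases i with rfl | rfl
  · simp [parity, proj, Submodule.projection_apply_of_mem_left _ hx,
      Submodule.projection_apply_of_mem_right _ hx]
  · simp [parity, proj, Submodule.projection_apply_of_mem_left _ hx,
      Submodule.projection_apply_of_mem_right _ hx]

theorem exists_add (x : g) : ∃ y ∈ L.part 0, ∃ z ∈ L.part 1, y + z = x :=
  Submodule.mem_sup.1 (by rw [L.isCompl.sup_eq_top]; trivial)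

theorem parity_parity (x : g) : L.parity (L.parity x) = x := by
  obtain ⟨y, hy, z, hz, rfl⟩ := L.exists_add x
  simp [L.parity_of_mem hy, L.parity_of_mem hz]

/-- The supertrace of an endomorphism of `g`: the trace of its even-even block minus the trace of
its odd-odd block. -/
def str (T : Module.End ℂ g) : ℂ := LinearMap.trace ℂ g (L.parity ∘ₗ T)

/-! ### The universal enveloping algebra -/

/-- The relations `x y = (-1)^{p(x)p(y)} y x + [x, y]` for homogeneous `x`, `y`. -/
inductive URel : TensorAlgebra ℂ g → TensorAlgebra ℂ g → Prop
  | mk {i j : ZMod 2} {x y : g} (hx : x ∈ L.part i) (hy : y ∈ L.part j) :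
      URel (TensorAlgebra.ι ℂ x * TensorAlgebra.ι ℂ y)
        (((-1 : ℤˣ) ^ (i * j)) • (TensorAlgebra.ι ℂ y * TensorAlgebra.ι ℂ x) +
          TensorAlgebra.ι ℂ (L.bracket x y))

/-- The universal enveloping algebra of a Lie superalgebra. -/
def U : Type _ := RingQuot L.URel

instance : Ring L.U := inferInstanceAs (Ring (RingQuot L.URel))
instance : Algebra ℂ L.U := inferInstanceAs (Algebra ℂ (RingQuot L.URel))

/-- The canonical map `g → U(g)`. -/
def ιU : g →ₗ[ℂ] L.U :=
  (RingQuot.mkAlgHom ℂ L.URel).toLinearMap ∘ₗ TensorAlgebra.ι ℂ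

theorem ιU_mul_ιU {i j : ZMod 2} {x y : g} (hx : x ∈ L.part i) (hy : y ∈ L.part j) :
    L.ιU x * L.ιU y = ((-1 : ℤˣ) ^ (i * j)) • (L.ιU y * L.ιU x) + L.ιU (L.bracket x y) := by
  have h := RingQuot.mkAlgHom_rel ℂ (URel.mk (L := L) hx hy)
  rw [map_add, map_mul, Units.smul_def, map_zsmul, map_mul] at h
  exact h

/-- The universal property of `U(g)`. -/
def liftU {A : Type*} [Ring A] [Algebra ℂ A] (f : g →ₗ[ℂ] A)
    (hf : ∀ (i j : ZMod 2) (x y : g), x ∈ L.part i → y ∈ L.part j →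
      f x * f y = ((-1 : ℤˣ) ^ (i * j)) • (f y * f x) + f (L.bracket x y)) : L.U →ₐ[ℂ] A :=
  RingQuot.liftAlgHom ℂ ⟨TensorAlgebra.lift ℂ f, by
    rintro _ _ ⟨hx, hy⟩
    rw [map_add, map_mul, Units.smul_def, map_zsmul, map_mul]
    simp only [TensorAlgebra.lift_ι_apply]
    exact hf _ _ _ _ hx hy⟩

@[simp]
theorem liftU_ιU {A : Type*} [Ring A] [Algebra ℂ A] (f : g →ₗ[ℂ] A)
    (hf : ∀ (i j : ZMod 2) (x y : g), x ∈ L.part i → y ∈ L.part j →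
      f x * f y = ((-1 : ℤˣ) ^ (i * j)) • (f y * f x) + f (L.bracket x y)) (x : g) :
    L.liftU f hf (L.ιU x) = f x := by
  have h := RingQuot.liftAlgHom_mkAlgHom_apply (S := ℂ) (TensorAlgebra.lift ℂ f)
    (s := L.URel) (by
      rintro _ _ ⟨hx, hy⟩
      rw [map_add, map_mul, Units.smul_def, map_zsmul, map_mul]
      simp only [TensorAlgebra.lift_ι_apply]
      exact hf _ _ _ _ hx hy) (TensorAlgebra.ι ℂ x)
  rw [TensorAlgebra.lift_ι_apply] at h
  exact h

theorem U_hom_ext {A : Type*} [Ring A] [Algebra ℂ A] {f₁ f₂ : L.U →ₐ[ℂ] A}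
    (h : ∀ x, f₁ (L.ιU x) = f₂ (L.ιU x)) : f₁ = f₂ := by
  apply RingQuot.ringQuot_ext' (S := ℂ)
  apply TensorAlgebra.hom_ext
  ext x
  exact h x

/-- The parity automorphism of `U(g)`, induced by that of `g`. -/
def parityU : L.U →ₐ[ℂ] L.U :=
  L.liftU (L.ιU ∘ₗ L.parity) (by
    intro i j x y hx hy
    simp only [LinearMap.comp_apply, L.parity_of_mem hx, L.parity_of_mem hy,
      L.parity_of_mem (L.bracket_mem hx hy), uzpow_add, Units.smul_def, map_zsmul]
    simp only [← Units.smul_def, smul_mul_smul_comm, L.ιU_mul_ιU hx hy, smul_add]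
    rw [mul_comm ((-1 : ℤˣ) ^ j), smul_comm])

theorem parityU_ιU (x : g) : L.parityU (L.ιU x) = L.ιU (L.parity x) :=
  L.liftU_ιU _ _ x

theorem parityU_parityU (u : L.U) : L.parityU (L.parityU u) = u := by
  have h : L.parityU.comp L.parityU = AlgHom.id ℂ L.U := by
    apply L.U_hom_ext
    intro x
    rw [AlgHom.comp_apply, L.parityU_ιU, L.parityU_ιU, L.parity_parity, AlgHom.id_apply]
  exact DFunLike.congr_fun h u

/-- The `ℤ/2`-grading of `U(g)` induced by the parity of `g`. -/
abbrev gradingU : ZMod 2 → Submodule ℂ L.U := parityGrading L.parityU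

instance : GradedAlgebra L.gradingU := parityGradedAlgebra L.parityU L.parityU_parityU

/-- The extension of the adjoint representation to an algebra homomorphism `U(g) → End(g)`. -/
def adU : L.U →ₐ[ℂ] Module.End ℂ g :=
  L.liftU L.bracket (by
    intro i j x y hx hy
    ext z
    simp only [Module.End.mul_apply, LinearMap.add_apply, Units.smul_def, LinearMap.smul_apply]
    rw [L.jacobi hx hy z, Units.smul_def, add_comm])

/-! ### Basic classical Lie superalgebras -/

/-- A Lie superalgebra is simple if it is not abelian and has no graded ideals other than `0` and
itself. -/
def IsSimple : Prop :=
  L.bracket ≠ 0 ∧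
    ∀ I : Submodule ℂ g, (∀ x, ∀ y ∈ I, L.bracket x y ∈ I) → (∀ i, ∀ y ∈ I, L.proj i y ∈ I) →
      I = ⊥ ∨ I = ⊤

/-- The even part, as a Lie algebra. -/
def Even : Type _ := L.part 0

instance : AddCommGroup L.Even := inferInstanceAs (AddCommGroup (L.part 0))
instance : Module ℂ L.Even := inferInstanceAs (Module ℂ (L.part 0))

theorem skew_even {x y : g} (hx : x ∈ L.part 0) (hy : y ∈ L.part 0) :
    L.bracket x y = -L.bracket y x := by
  simpa using L.skew hx hy

instance : LieRing L.Even where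
  bracket x y := (⟨L.bracket x.1 y.1, L.bracket_mem x.2 y.2⟩ : L.part 0)
  add_lie x y z := Subtype.ext (by
    change L.bracket (x.1 + y.1) z.1 = L.bracket x.1 z.1 + L.bracket y.1 z.1
    simp)
  lie_add x y z := Subtype.ext (by
    change L.bracket x.1 (y.1 + z.1) = L.bracket x.1 y.1 + L.bracket x.1 z.1
    simp)
  lie_self x := Subtype.ext (by
    change L.bracket x.1 x.1 = 0
    have h := L.skew_even x.2 x.2
    have h2 : (2 : ℂ) • L.bracket x.1 x.1 = 0 := by
      rw [two_smul]
      nth_rewrite 1 [h]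
      exact neg_add_cancel _
    exact (smul_eq_zero.1 h2).resolve_left two_ne_zero)
  leibniz_lie x y z := Subtype.ext (by
    change L.bracket x.1 (L.bracket y.1 z.1) =
      L.bracket (L.bracket x.1 y.1) z.1 + L.bracket y.1 (L.bracket x.1 z.1)
    simpa using L.jacobi x.2 y.2 z.1)

instance : LieAlgebra ℂ L.Even where
  toModule := inferInstance
  lie_smul t x y := Subtype.ext (by
    change L.bracket x.1 (t • y.1) = t • L.bracket x.1 y.1
    simp)

/-- `h` is a Cartan subalgebra: a self-centralizing abelian subalgebra of the even part whose
elements act semisimply on `g`. -/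
structure IsCartan (h : Submodule ℂ g) : Prop where
  le_even : h ≤ L.part 0
  abelian : ∀ x ∈ h, ∀ y ∈ h, L.bracket x y = 0
  semisimple : ∀ x ∈ h, Module.End.IsSemisimple (L.bracket x)
  self_centralizing : ∀ x ∈ L.part 0, (∀ y ∈ h, L.bracket y x = 0) → x ∈ h

variable (h : Submodule ℂ g)

/-- The space `g^α` of all `x` with `[H, x] = α(H) x` for all `H` in `h`. -/
def rootSpace (α : Module.Dual ℂ h) : Submodule ℂ g where
  carrier := {x | ∀ H : h, L.bracket H x = α H • x}
  add_mem' := by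
    intro x y hx hy H
    rw [map_add, hx H, hy H, smul_add]
  zero_mem' := by simp
  smul_mem' := by
    intro c x hx H
    rw [map_smul, hx H, smul_comm]

/-- `α` is a root of `g` with respect to `h`. -/
def IsRoot (α : Module.Dual ℂ h) : Prop := α ≠ 0 ∧ L.rootSpace h α ≠ ⊥

/-- `P` is a positive system of roots: a closed set of roots that contains exactly one of `α`
and `-α` for every root `α`. -/
structure IsPositiveSystem (P : Finset (Module.Dual ℂ h)) : Prop where
  isRoot : ∀ α ∈ P, L.IsRoot h α
  mem_or_neg_mem : ∀ α, L.IsRoot h α → α ∈ P ∨ -α ∈ P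
  neg_notMem : ∀ α ∈ P, -α ∉ P
  add_mem : ∀ α ∈ P, ∀ β ∈ P, L.IsRoot h (α + β) → α + β ∈ P

/-- Half the sum of the roots in `P` of parity `i`, counted with the multiplicity
`dim (g^α ∩ g_i)`. -/
def halfSum (P : Finset (Module.Dual ℂ h)) (i : ZMod 2) : Module.Dual ℂ h :=
  (1 / 2 : ℂ) • ∑ α ∈ P, Module.finrank ℂ ↥(L.rootSpace h α ⊓ L.part i) • α

/-- The Weyl vector `ρ = ρ₀ - ρ₁` of a positive system. -/
def weylVector (P : Finset (Module.Dual ℂ h)) : Module.Dual ℂ h :=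
  L.halfSum h P 0 - L.halfSum h P 1

end LieSuperalgebra

/-! ### Quadratic Lie superalgebras -/

/-- A quadratic Lie superalgebra: a Lie superalgebra with a non-degenerate, invariant,
supersymmetric and consistent bilinear form. -/
structure QuadraticLieSuperalgebra (g : Type*) [AddCommGroup g] [Module ℂ g] extends
    LieSuperalgebra g where
  form : LinearMap.BilinForm ℂ g
  nondegenerate : form.Nondegenerate
  invariant : ∀ x y z : g, form (bracket x y) z = form x (bracket y z)
  supersymmetric : ∀ {i j : ZMod 2} {x y : g}, x ∈ part i → y ∈ part j →
    form x y = ((-1 : ℤˣ) ^ (i * j)) • form y x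
  consistent : ∀ {i j : ZMod 2} {x y : g}, x ∈ part i → y ∈ part j → i ≠ j → form x y = 0

namespace QuadraticLieSuperalgebra

variable {g : Type*} [AddCommGroup g] [Module ℂ g] (Q : QuadraticLieSuperalgebra g)

/-- `g` is basic classical: it is simple and its even part is a reductive Lie algebra (and it
carries the form of a quadratic Lie superalgebra). -/
def IsBasicClassical : Prop :=
  Q.IsSimple ∧ LieAlgebra.HasCentralRadical ℂ Q.Even

/-! ### The Clifford algebra -/

/-- The relations `x y + (-1)^{p(x)p(y)} y x = 2 B(x, y)` for homogeneous `x`, `y`. -/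
inductive ClRel : TensorAlgebra ℂ g → TensorAlgebra ℂ g → Prop
  | mk {i j : ZMod 2} {x y : g} (hx : x ∈ Q.part i) (hy : y ∈ Q.part j) :
      ClRel (TensorAlgebra.ι ℂ x * TensorAlgebra.ι ℂ y +
          ((-1 : ℤˣ) ^ (i * j)) • (TensorAlgebra.ι ℂ y * TensorAlgebra.ι ℂ x))
        (algebraMap ℂ (TensorAlgebra ℂ g) (2 * Q.form x y))

/-- The Clifford algebra of a quadratic Lie superalgebra. -/
def Cl : Type _ := RingQuot Q.ClRel

instance : Ring Q.Cl := inferInstanceAs (Ring (RingQuot Q.ClRel))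
instance : Algebra ℂ Q.Cl := inferInstanceAs (Algebra ℂ (RingQuot Q.ClRel))

/-- The canonical map `g → Cl(g)`. -/
def ιCl : g →ₗ[ℂ] Q.Cl :=
  (RingQuot.mkAlgHom ℂ Q.ClRel).toLinearMap ∘ₗ TensorAlgebra.ι ℂ

theorem ιCl_mul_ιCl {i j : ZMod 2} {x y : g} (hx : x ∈ Q.part i) (hy : y ∈ Q.part j) :
    Q.ιCl x * Q.ιCl y + ((-1 : ℤˣ) ^ (i * j)) • (Q.ιCl y * Q.ιCl x) =
      algebraMap ℂ Q.Cl (2 * Q.form x y) := by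
  have h := RingQuot.mkAlgHom_rel ℂ (ClRel.mk (Q := Q) hx hy)
  rw [map_add, map_mul, Units.smul_def, map_zsmul, map_mul, AlgHom.commutes] at h
  exact h

/-- The universal property of `Cl(g)`. -/
def liftCl {A : Type*} [Ring A] [Algebra ℂ A] (f : g →ₗ[ℂ] A)
    (hf : ∀ (i j : ZMod 2) (x y : g), x ∈ Q.part i → y ∈ Q.part j →
      f x * f y + ((-1 : ℤˣ) ^ (i * j)) • (f y * f x) = algebraMap ℂ A (2 * Q.form x y)) :
    Q.Cl →ₐ[ℂ] A :=
  RingQuot.liftAlgHom ℂ ⟨TensorAlgebra.lift ℂ f, by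
    rintro _ _ ⟨hx, hy⟩
    rw [map_add, map_mul, Units.smul_def, map_zsmul, map_mul, AlgHom.commutes]
    simp only [TensorAlgebra.lift_ι_apply]
    exact hf _ _ _ _ hx hy⟩

@[simp]
theorem liftCl_ιCl {A : Type*} [Ring A] [Algebra ℂ A] (f : g →ₗ[ℂ] A)
    (hf : ∀ (i j : ZMod 2) (x y : g), x ∈ Q.part i → y ∈ Q.part j →
      f x * f y + ((-1 : ℤˣ) ^ (i * j)) • (f y * f x) = algebraMap ℂ A (2 * Q.form x y)) (x : g) :
    Q.liftCl f hf (Q.ιCl x) = f x := by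
  have h := RingQuot.liftAlgHom_mkAlgHom_apply (S := ℂ) (TensorAlgebra.lift ℂ f)
    (s := Q.ClRel) (by
      rintro _ _ ⟨hx, hy⟩
      rw [map_add, map_mul, Units.smul_def, map_zsmul, map_mul, AlgHom.commutes]
      simp only [TensorAlgebra.lift_ι_apply]
      exact hf _ _ _ _ hx hy) (TensorAlgebra.ι ℂ x)
  rw [TensorAlgebra.lift_ι_apply] at h
  exact h

theorem Cl_hom_ext {A : Type*} [Ring A] [Algebra ℂ A] {f₁ f₂ : Q.Cl →ₐ[ℂ] A}
    (h : ∀ x, f₁ (Q.ιCl x) = f₂ (Q.ιCl x)) : f₁ = f₂ := by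
  apply RingQuot.ringQuot_ext' (S := ℂ)
  apply TensorAlgebra.hom_ext
  ext x
  exact h x

/-- The parity automorphism of `Cl(g)`, induced by that of `g`. -/
def parityCl : Q.Cl →ₐ[ℂ] Q.Cl :=
  Q.liftCl (Q.ιCl ∘ₗ Q.parity) (by
    intro i j x y hx hy
    simp only [LinearMap.comp_apply, Q.parity_of_mem hx, Q.parity_of_mem hy,
      Units.smul_def, map_zsmul]
    simp only [← Units.smul_def, smul_mul_smul_comm]
    rw [mul_comm ((-1 : ℤˣ) ^ j), smul_comm, ← smul_add, Q.ιCl_mul_ιCl hx hy]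
    by_cases hij : i = j
    · subst hij
      rw [Int.units_mul_self, one_smul]
    · rw [Q.consistent hx hy hij]
      simp)

theorem parityCl_ιCl (x : g) : Q.parityCl (Q.ιCl x) = Q.ιCl (Q.parity x) :=
  Q.liftCl_ιCl _ _ x

theorem parityCl_parityCl (c : Q.Cl) : Q.parityCl (Q.parityCl c) = c := by
  have h : Q.parityCl.comp Q.parityCl = AlgHom.id ℂ Q.Cl := by
    apply Q.Cl_hom_ext
    intro x
    rw [AlgHom.comp_apply, Q.parityCl_ιCl, Q.parityCl_ιCl, Q.parity_parity, AlgHom.id_apply]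
  exact DFunLike.congr_fun h c

/-- The `ℤ/2`-grading of `Cl(g)` induced by the parity of `g`. -/
abbrev gradingCl : ZMod 2 → Submodule ℂ Q.Cl := parityGrading Q.parityCl

instance : GradedAlgebra Q.gradingCl := parityGradedAlgebra Q.parityCl Q.parityCl_parityCl

/-- The colour quantum Weil algebra: the `ℤ/2`-graded tensor product `U(g) ⊗ Cl(g)`, with product
`(u ⊗ c)(u' ⊗ c') = (-1)^{p(c)p(u')} u u' ⊗ c c'`. -/
abbrev W : Type _ := GradedTensorProduct ℂ Q.gradingU Q.gradingCl

/-! ### The cubic Dirac operator -/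

/-- A homogeneous basis `e` of `g`, the parities of its members, and the `B`-dual basis, which is
normalized by `B(e_a, e^b) = δ_{ab}`. -/
structure DualBases (n : Type*) where
  e : Module.Basis n ℂ g
  p : n → ZMod 2
  e_mem : ∀ a, e a ∈ Q.part (p a)
  dual : n → g
  form_self : ∀ a, Q.form (e a) (dual a) = 1
  form_ne : ∀ a b, a ≠ b → Q.form (e a) (dual b) = 0

/-- The sign `p(σ; x₁, …, x_k)` for elements of parities `p`: the signature of `σ` times the
product of `(-1)^{p_i p_j}` over all `i < j` with `σ⁻¹ i > σ⁻¹ j`. -/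
def permSign {k : ℕ} (p : Fin k → ZMod 2) (σ : Equiv.Perm (Fin k)) : ℤˣ :=
  Equiv.Perm.sign σ *
    ∏ ij : Fin k × Fin k with ij.1 < ij.2 ∧ σ⁻¹ ij.2 < σ⁻¹ ij.1, (-1 : ℤˣ) ^ (p ij.1 * p ij.2)

/-- The quantization `q(x₁ ∧ ⋯ ∧ x_k)` in `Cl(g)` of an exterior product of elements `x_i` of
parities `p_i`:
`(1 / k!) ∑_σ p(σ; x₁, …, x_k) x_{σ(1)} ⋯ x_{σ(k)}`. -/
def quantize {k : ℕ} (p : Fin k → ZMod 2) (x : Fin k → g) : Q.Cl :=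
  (1 / (k ! : ℂ)) • ∑ σ : Equiv.Perm (Fin k),
    permSign p σ • (List.ofFn fun i => Q.ιCl (x (σ i))).prod

variable {n : Type*} [Fintype n] (E : Q.DualBases n)

/-- The quadratic Casimir element `∑ e^a e_a` of `U(g)`. -/
def casimir : Q.U := ∑ a, Q.ιU (E.dual a) * Q.ιU (E.e a)

/-- The quantization `φ'` of the structure constants tensor
`φ = -(1/12) ∑ (-1)^{p_a p_b + p_c} f_{abc} e^a ∧ e^b ∧ e^c`, where
`f_{abc} = B([e_a, e_b], e_c)`; this is the cubic element that corresponds under `B` to the Cartan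
form `(x, y, z) ↦ -(1/2) B([x, y], z)`. -/
def cubic : Q.Cl :=
  (-(1 / 12) : ℂ) • ∑ a, ∑ b, ∑ c,
    (((-1 : ℤˣ) ^ (E.p a * E.p b + E.p c)) • Q.form (Q.bracket (E.e a) (E.e b)) (E.e c)) •
      Q.quantize ![E.p a, E.p b, E.p c] ![E.dual a, E.dual b, E.dual c]

/-- The cubic Dirac operator `D = ∑ e^a ⊗ e_a + 1 ⊗ φ'`. -/
def dirac : Q.W :=
  ∑ a, GradedTensorProduct.tmul ℂ (Q.ιU (E.dual a)) (Q.ιCl (E.e a)) +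
    GradedTensorProduct.tmul ℂ 1 (Q.cubic E)

/-- The form on the dual of a subspace `h` obtained from the restriction of `B` to `h`, when the
latter is non-degenerate: `(α, β) ↦ B(t_α, t_β)`, where `B(t_α, H) = α(H)` for all `H` in `h`. -/
def dualForm [FiniteDimensional ℂ g] (h : Submodule ℂ g)
    (hh : (Q.form.restrict h).Nondegenerate) (α β : Module.Dual ℂ h) : ℂ :=
  Q.form.restrict h (((Q.form.restrict h).toDual hh).symm α)
    (((Q.form.restrict h).toDual hh).symm β)

end QuadraticLieSuperalgebra

end

/-! In `Cl(g)` put `μ(z) = ∑ e^a [e_a, z]` (`moment`) and `C = ∑ e^a μ(e_a)` (`cubicSum`). The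
structure constants form a super-antisymmetric tensor, so quantizing it only reorders equal
summands, and `φ' = C / 12` (`cubic_eq`). The Clifford relations show that the supercommutator of
`x` with `μ(z)` is `4 [x, z]`, and that `x C + C x = 6 μ(x)`.

The square of `∑ e^a ⊗ e_a` is `Ω ⊗ 1 - (1/2) ∑ e^a ⊗ μ(e_a)`: the commutators in `U(g)` produce the
second term, the contractions in `Cl(g)` the first. The cross terms with `φ'` give `+(1/2) ∑ e^a ⊗
μ(e_a)`, so only `φ'^2` is left. Its value rests on the Jacobi identity, in the form `∑ μ(e^b) [e_b,
z] = 2 Cas(z)` with `Cas = ad Ω` (`quartic_eq`). Hence `C` commutes with `μ(z)`, and `2 C^2 = 6 ∑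
μ(e^a) μ(e_a) = 12 ∑ Cas(e^b) e_b`. Since `Cas` is self-adjoint, the last sum is the scalar `str(ad
Ω)`; so `C^2 = 6 str(ad Ω)` and `φ'^2 = str(ad Ω) / 24`.

The second formula then amounts to `str(ad Ω) = 24 B(ρ, ρ)`. The supertrace is the full contraction
of the Cartan cubic form with itself, `tri id id id`. Let `P`, `O`, `N` be the projections onto
positive, zero and negative weights. Of the 27 terms, all vanish except those of type `PPN`, `PNN`,
`PNO`, and adjointness of `P` and `N` turns their sum into `6 (tri P N id - tri P P id)`. By
invariance and Jacobi this is `6 B(r, r)` with `r = ∑ [P e^a, e_a]`. Finally `r` lies in `h` and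
`B(r, H) = str(P ad H) = 2 ρ(H)`, so `r` is twice the vector dual to `ρ`, and `6 * 4 = 24`. -/

noncomputable section

/-! ### Signs and bilinear functions -/

/-- The sign `(-1) ^ i` as a complex number. -/
def sgn (i : ZMod 2) : ℂ := (((-1 : ℤˣ) ^ i : ℤˣ) : ℤ)

@[simp] theorem sgn_zero : sgn 0 = 1 := by simp [sgn]

@[simp] theorem sgn_one : sgn 1 = -1 := by simp [sgn]

theorem sgn_add (i j : ZMod 2) : sgn (i + j) = sgn i * sgn j := by
  simp [sgn, uzpow_add]

theorem sgn_mul_self (i : ZMod 2) : sgn i * sgn i = 1 := by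
  rcases zmod_two_cases i with rfl | rfl <;> simp

theorem zmod_two_one_add_one : (1 : ZMod 2) + 1 = 0 := by decide

theorem units_smul_eq_sgn {M : Type*} [AddCommGroup M] [Module ℂ M] (i : ZMod 2) (x : M) :
    ((-1 : ℤˣ) ^ i) • x = sgn i • x := by
  rcases zmod_two_cases i with rfl | rfl <;> simp

/-- A function of two variables that is linear in each of them. -/
structure IsBilin {V W M : Type*} [AddCommGroup V] [Module ℂ V] [AddCommGroup W] [Module ℂ W]
    [AddCommGroup M] [Module ℂ M] (F : V → W → M) : Prop where
  add_left : ∀ x y z, F (x + y) z = F x z + F y z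
  smul_left : ∀ (c : ℂ) x z, F (c • x) z = c • F x z
  add_right : ∀ x y z, F x (y + z) = F x y + F x z
  smul_right : ∀ (c : ℂ) x z, F x (c • z) = c • F x z

/-- The bilinear map given by a function that is linear in both variables. -/
def IsBilin.toLin {V W M : Type*} [AddCommGroup V] [Module ℂ V] [AddCommGroup W] [Module ℂ W]
    [AddCommGroup M] [Module ℂ M] {F : V → W → M} (hF : IsBilin F) : V →ₗ[ℂ] W →ₗ[ℂ] M :=
  LinearMap.mk₂ ℂ F hF.add_left hF.smul_left hF.add_right hF.smul_right

theorem IsBilin.toLin_apply {V W M : Type*} [AddCommGroup V] [Module ℂ V] [AddCommGroup W]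
    [Module ℂ W] [AddCommGroup M] [Module ℂ M] {F : V → W → M} (hF : IsBilin F) (x : V) (y : W) :
    hF.toLin x y = F x y := rfl

/-! ### Sign rules as linear identities -/

namespace LieSuperalgebra

variable {g : Type*} [AddCommGroup g] [Module ℂ g] (L : LieSuperalgebra g)

/-- The `i`-th power of the parity involution. -/
def twist (i : ZMod 2) : g →ₗ[ℂ] g := if i = 0 then LinearMap.id else L.parity

@[simp] theorem twist_zero (x : g) : L.twist 0 x = x := by simp [twist]

@[simp] theorem twist_one (x : g) : L.twist 1 x = L.parity x := by simp [twist]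

theorem twist_of_mem {i j : ZMod 2} {x : g} (hx : x ∈ L.part j) :
    L.twist i x = sgn (i * j) • x := by
  rcases zmod_two_cases i with rfl | rfl
  · simp
  · rw [twist_one, L.parity_of_mem hx, units_smul_eq_sgn, one_mul]

theorem parity_eq {j : ZMod 2} {x : g} (hx : x ∈ L.part j) : L.parity x = sgn j • x := by
  rw [L.parity_of_mem hx, units_smul_eq_sgn]

theorem twist_twist (i : ZMod 2) (x : g) : L.twist i (L.twist i x) = x := by
  rcases zmod_two_cases i with rfl | rfl
  · simp
  · simp [L.parity_parity]

theorem mem_part_of_parity {j : ZMod 2} {x : g} (h : L.parity x = sgn j • x) : x ∈ L.part j := by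
  obtain ⟨y, hy, z, hz, rfl⟩ := L.exists_add x
  rw [map_add, L.parity_eq hy, L.parity_eq hz] at h
  rcases zmod_two_cases j with rfl | rfl
  · have : (2 : ℂ) • z = 0 := by
      rw [two_smul]
      simpa [neg_eq_iff_add_eq_zero] using h
    rw [(smul_eq_zero.1 this).resolve_left two_ne_zero, add_zero]
    exact hy
  · have : (2 : ℂ) • y = 0 := by
      rw [two_smul]
      simpa [← sub_eq_add_neg, eq_neg_iff_add_eq_zero] using h
    rw [(smul_eq_zero.1 this).resolve_left two_ne_zero, zero_add]
    exact hz

/-- Two linear maps agree if they agree on homogeneous elements. -/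
theorem hom_ext {M : Type*} [AddCommGroup M] [Module ℂ M] {f₁ f₂ : g →ₗ[ℂ] M}
    (h : ∀ j, ∀ x ∈ L.part j, f₁ x = f₂ x) : f₁ = f₂ := by
  ext x
  obtain ⟨y, hy, z, hz, rfl⟩ := L.exists_add x
  rw [map_add, map_add, h 0 y hy, h 1 z hz]

theorem skew_sgn {i j : ZMod 2} {x y : g} (hx : x ∈ L.part i) (hy : y ∈ L.part j) :
    L.bracket x y = -(sgn (i * j) • L.bracket y x) := by
  rw [L.skew hx hy, units_smul_eq_sgn]

theorem jacobi_sgn {i j : ZMod 2} {x y : g} (hx : x ∈ L.part i) (hy : y ∈ L.part j) (z : g) :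
    L.bracket x (L.bracket y z) =
      L.bracket (L.bracket x y) z + sgn (i * j) • L.bracket y (L.bracket x z) := by
  rw [L.jacobi hx hy, units_smul_eq_sgn]

/-- Absorbing the sign `(-1)^{p(x)p(y)}` into a power of the parity involution makes the rule linear
in `y`, so that it also applies to inhomogeneous `y`. -/
theorem skew_twist {i : ZMod 2} {x : g} (hx : x ∈ L.part i) (y : g) :
    L.bracket x y = -L.bracket (L.twist i y) x := by
  have : L.bracket x = -(L.bracket.flip x ∘ₗ L.twist i) := by
    apply L.hom_ext
    intro j y hy
    simp [L.twist_of_mem hy, L.skew_sgn hx hy]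
  simpa using DFunLike.congr_fun this y

theorem twist_bracket (i : ZMod 2) (x y : g) :
    L.twist i (L.bracket x y) = L.bracket (L.twist i x) (L.twist i y) := by
  have : L.bracket.compr₂ (L.twist i) = L.bracket.compl₁₂ (L.twist i) (L.twist i) := by
    apply L.hom_ext
    intro j x hx
    apply L.hom_ext
    intro k y hy
    simp [L.twist_of_mem hx, L.twist_of_mem hy, L.twist_of_mem (L.bracket_mem hx hy), mul_add,
      sgn_add, smul_smul, mul_comm]
  exact LinearMap.congr_fun₂ this x y

end LieSuperalgebra

/-! ### The invariant form and the canonical tensor `∑ e^a ⊗ e_a` -/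

namespace QuadraticLieSuperalgebra

variable {g : Type*} [AddCommGroup g] [Module ℂ g] (Q : QuadraticLieSuperalgebra g)

theorem form_eq_zero {i j : ZMod 2} {x y : g} (hx : x ∈ Q.part i) (hy : y ∈ Q.part j)
    (h : i ≠ j) : Q.form x y = 0 := Q.consistent hx hy h

theorem form_symm_left {i : ZMod 2} {x : g} (hx : x ∈ Q.part i) (y : g) :
    Q.form x y = sgn i * Q.form y x := by
  have : Q.form x = sgn i • Q.form.flip x := by
    apply Q.hom_ext
    intro j y hy
    by_cases hij : i = j
    · subst hij
      rw [Q.supersymmetric hx hy, units_smul_eq_sgn]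
      rcases zmod_two_cases i with rfl | rfl <;> simp
    · simp [Q.form_eq_zero hx hy hij, Q.form_eq_zero hy hx (Ne.symm hij)]
  simpa using DFunLike.congr_fun this y

theorem form_symm_right {i : ZMod 2} {x : g} (hx : x ∈ Q.part i) (y : g) :
    Q.form y x = sgn i * Q.form x y := by
  rw [Q.form_symm_left hx, ← mul_assoc, sgn_mul_self, one_mul]

theorem form_symm (x y : g) : Q.form x y = Q.form (Q.parity y) x := by
  have : Q.form = (Q.form ∘ₗ Q.parity).flip := by
    apply Q.hom_ext
    intro j x hx
    ext y
    rw [Q.form_symm_left hx]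
    have : (sgn j • Q.form.flip x) = (Q.form ∘ₗ Q.parity).flip x := by
      apply Q.hom_ext
      intro k y hy
      by_cases hij : j = k
      · subst hij
        simp [Q.parity_eq hy]
      · simp [Q.parity_eq hy, Q.form_eq_zero hy hx (Ne.symm hij)]
    exact DFunLike.congr_fun this y
  exact LinearMap.congr_fun₂ this x y

theorem form_twist {i : ZMod 2} {x : g} (hx : x ∈ Q.part i) (y : g) :
    Q.form x y = Q.form (Q.twist i y) x := by
  have : Q.form x = Q.form.flip x ∘ₗ Q.twist i := by
    apply Q.hom_ext
    intro j y hy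
    by_cases hij : i = j
    · subst hij
      rw [Q.form_symm_left hx]
      rcases zmod_two_cases i with rfl | rfl <;> simp [Q.parity_eq hy]
    · simp [Q.form_eq_zero hx hy hij, Q.form_eq_zero hy hx (Ne.symm hij), Q.twist_of_mem hy]
  exact DFunLike.congr_fun this y

theorem form_twist_left (i : ZMod 2) (x y : g) :
    Q.form (Q.twist i x) y = Q.form x (Q.twist i y) := by
  have : Q.form ∘ₗ Q.twist i = Q.form.compl₂ (Q.twist i) := by
    apply Q.hom_ext
    intro j x hx
    apply Q.hom_ext
    intro k y hy
    by_cases hij : j = k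
    · subst hij
      simp [Q.twist_of_mem hx, Q.twist_of_mem hy]
    · simp [Q.form_eq_zero hx hy hij, Q.twist_of_mem hx, Q.twist_of_mem hy]
  exact LinearMap.congr_fun₂ this x y

theorem eq_of_form_eq {x y : g} (h : ∀ z, Q.form z x = Q.form z y) : x = y := by
  rw [← sub_eq_zero]
  apply Q.nondegenerate.2
  intro z
  rw [map_sub, h z, sub_self]

namespace DualBases

variable {Q} {n : Type*} (E : Q.DualBases n)

/-- Parity is self-adjoint for `B`, and `B(·, e^a)` determines `e^a`; so it suffices to compare
these functionals on the homogeneous basis. -/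
theorem dual_mem (a : n) : E.dual a ∈ Q.part (E.p a) := by
  classical
  apply Q.mem_part_of_parity
  apply Q.eq_of_form_eq
  intro z
  rw [← Q.twist_one, ← Q.form_twist_left, Q.twist_one]
  have : Q.form.flip (E.dual a) ∘ₗ Q.parity = sgn (E.p a) • Q.form.flip (E.dual a) := by
    apply E.e.ext
    intro b
    by_cases hb : b = a
    · subst hb
      simp [Q.parity_eq (E.e_mem b)]
    · simp [Q.parity_eq (E.e_mem b), E.form_ne b a hb]
  simpa using DFunLike.congr_fun this z

variable [Fintype n]

theorem eq_sum_form_dual (x : g) : x = ∑ a, Q.form x (E.dual a) • E.e a := by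
  classical
  conv_lhs => rw [← E.e.sum_repr x]
  refine Finset.sum_congr rfl fun a _ => ?_
  congr 1
  conv_rhs => rw [← E.e.sum_repr x]
  rw [map_sum, LinearMap.sum_apply, Finset.sum_eq_single a]
  · simp [E.form_self]
  · intro b _ hb
    simp [E.form_ne b a hb]
  · simp

theorem eq_sum_form_e (x : g) : x = ∑ a, Q.form (E.e a) x • E.dual a := by
  classical
  apply Q.eq_of_form_eq
  intro z
  rw [map_sum]
  conv_lhs => rw [E.eq_sum_form_dual z]
  rw [map_sum, LinearMap.sum_apply]
  refine Finset.sum_congr rfl fun a _ => ?_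
  simp [mul_comm]

/-- The canonical tensor `∑ e^a ⊗ e_a` moves an operator to its adjoint. -/
theorem sum_adjoint {M : Type*} [AddCommGroup M] [Module ℂ M] (F : g → g → M)
    {T S : g → g} (h : ∀ x y, Q.form (T x) y = Q.form x (S y))
    (hF : IsBilin F := by
      constructor <;> intros <;>
        simp [mul_add, add_mul, smul_add, Finset.sum_add_distrib, Finset.smul_sum, smul_smul,
          mul_assoc, mul_left_comm, mul_comm]) :
    ∑ a, F (S (E.dual a)) (E.e a) = ∑ a, F (E.dual a) (T (E.e a)) := by
  have h1 (a) : F (S (E.dual a)) (E.e a) =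
      ∑ b, Q.form (E.e b) (S (E.dual a)) • F (E.dual b) (E.e a) := by
    conv_lhs => rw [E.eq_sum_form_e (S (E.dual a)), ← hF.toLin_apply, map_sum]
    simp [hF.toLin_apply]
  have h2 (b) : F (E.dual b) (T (E.e b)) =
      ∑ a, Q.form (T (E.e b)) (E.dual a) • F (E.dual b) (E.e a) := by
    conv_lhs => rw [E.eq_sum_form_dual (T (E.e b)), ← hF.toLin_apply, map_sum]
    simp [hF.toLin_apply, hF.smul_right]
  simp only [h1, h2, h]
  exact Finset.sum_comm

/-- Invariance of `B` says that `x ↦ [x, y]` and `x ↦ [y, x]` are adjoint; this is the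
`ad`-invariance of the canonical tensor. -/
theorem sum_bracket {M : Type*} [AddCommGroup M] [Module ℂ M] (F : g → g → M) (y : g)
    (hF : IsBilin F := by
      constructor <;> intros <;>
        simp [mul_add, add_mul, smul_add, Finset.sum_add_distrib, Finset.smul_sum, smul_smul,
          mul_assoc, mul_left_comm, mul_comm]) :
    ∑ a, F (Q.bracket y (E.dual a)) (E.e a) = ∑ a, F (E.dual a) (Q.bracket (E.e a) y) :=
  E.sum_adjoint F (T := fun x => Q.bracket x y) (S := Q.bracket y)
    (fun x z => Q.invariant x y z) hF

theorem sum_twist {M : Type*} [AddCommGroup M] [Module ℂ M] (F : g → g → M) (i : ZMod 2)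
    (hF : IsBilin F := by
      constructor <;> intros <;>
        simp [mul_add, add_mul, smul_add, Finset.sum_add_distrib, Finset.smul_sum, smul_smul,
          mul_assoc, mul_left_comm, mul_comm]) :
    ∑ a, F (Q.twist i (E.dual a)) (E.e a) = ∑ a, F (E.dual a) (Q.twist i (E.e a)) :=
  E.sum_adjoint F (Q.form_twist_left i) hF

theorem sum_twist_twist {M : Type*} [AddCommGroup M] [Module ℂ M] (F : g → g → M) (i : ZMod 2)
    (hF : IsBilin F := by
      constructor <;> intros <;>
        simp [mul_add, add_mul, smul_add, Finset.sum_add_distrib, Finset.smul_sum, smul_smul,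
          mul_assoc, mul_left_comm, mul_comm]) :
    ∑ a, F (Q.twist i (E.dual a)) (Q.twist i (E.e a)) = ∑ a, F (E.dual a) (E.e a) := by
  have := E.sum_twist (fun x y => F x (Q.twist i y)) i
    ⟨fun _ _ _ => hF.add_left _ _ _, fun _ _ _ => hF.smul_left _ _ _,
      fun _ _ _ => by rw [map_add, hF.add_right], fun _ _ _ => by rw [map_smul, hF.smul_right]⟩
  simpa only [Q.twist_twist] using this

/-- The canonical tensor is supersymmetric. -/
theorem sum_flip {M : Type*} [AddCommGroup M] [Module ℂ M] (F : g → g → M)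
    (hF : IsBilin F := by
      constructor <;> intros <;>
        simp [mul_add, add_mul, smul_add, Finset.sum_add_distrib, Finset.smul_sum, smul_smul,
          mul_assoc, mul_left_comm, mul_comm]) :
    ∑ a, F (E.dual a) (E.e a) = ∑ a, sgn (E.p a) • F (E.e a) (E.dual a) := by
  have h1 (a) : F (E.dual a) (E.e a) =
      ∑ b, Q.form (E.dual a) (E.dual b) • F (E.e b) (E.e a) := by
    conv_lhs => rw [E.eq_sum_form_dual (E.dual a), ← hF.toLin_apply, map_sum]
    simp [hF.toLin_apply]
  have h2 (b) : F (E.e b) (E.dual b) =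
      ∑ a, Q.form (E.dual b) (E.dual a) • F (E.e b) (E.e a) := by
    conv_lhs => rw [E.eq_sum_form_dual (E.dual b), ← hF.toLin_apply, map_sum]
    simp [hF.toLin_apply, hF.smul_right]
  simp only [h1, h2, Finset.smul_sum, smul_smul]
  rw [Finset.sum_comm]
  refine Finset.sum_congr rfl fun b _ => Finset.sum_congr rfl fun a _ => ?_
  rw [Q.form_symm_right (E.dual_mem b)]

end DualBases

end QuadraticLieSuperalgebra

/-! ### Commutation rules in the Clifford algebra and the Casimir action -/

namespace QuadraticLieSuperalgebra

variable {g : Type*} [AddCommGroup g] [Module ℂ g] (Q : QuadraticLieSuperalgebra g)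

theorem ιCl_mul_twist {i : ZMod 2} {x : g} (hx : x ∈ Q.part i) (y : g) :
    Q.ιCl x * Q.ιCl y = -(Q.ιCl (Q.twist i y) * Q.ιCl x) + (2 * Q.form x y) • (1 : Q.Cl) := by
  have : (LinearMap.mul ℂ Q.Cl (Q.ιCl x)) ∘ₗ Q.ιCl =
      -((LinearMap.mul ℂ Q.Cl).flip (Q.ιCl x) ∘ₗ Q.ιCl ∘ₗ Q.twist i) +
        (2 : ℂ) • (Q.form x).smulRight (1 : Q.Cl) := by
    apply Q.hom_ext
    intro j y hy
    have h := Q.ιCl_mul_ιCl hx hy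
    rw [units_smul_eq_sgn, Algebra.algebraMap_eq_smul_one] at h
    simp [Q.twist_of_mem hy, ← h, smul_smul]
  simpa [smul_smul] using DFunLike.congr_fun this y

namespace DualBases

variable {Q} {n : Type*} [Fintype n] (E : Q.DualBases n)

/-- The element `∑ e^a [e_a, z]` of the Clifford algebra. -/
def moment : g →ₗ[ℂ] Q.Cl :=
  ∑ a, LinearMap.mul ℂ Q.Cl (Q.ιCl (E.dual a)) ∘ₗ Q.ιCl ∘ₗ Q.bracket (E.e a)

theorem moment_apply (z : g) :
    E.moment z = ∑ a, Q.ιCl (E.dual a) * Q.ιCl (Q.bracket (E.e a) z) := by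
  simp [moment]

theorem moment_apply' (z : g) :
    E.moment z = ∑ a, Q.ιCl (Q.bracket z (E.dual a)) * Q.ιCl (E.e a) := by
  rw [moment_apply]
  exact (E.sum_bracket (fun x y => Q.ιCl x * Q.ιCl y) z).symm

/-- Moving `x` past the two factors of each summand of `μ(z)` costs two contractions with `B`; each
sums to `2 [x, z]`. Thus `μ / 4` implements the adjoint action on generators. -/
theorem ιCl_mul_moment {i : ZMod 2} {x : g} (hx : x ∈ Q.part i) (z : g) :
    Q.ιCl x * E.moment z =
      E.moment (Q.twist i z) * Q.ιCl x + (4 : ℂ) • Q.ιCl (Q.bracket x z) := by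
  have h1 : ∑ a, Q.ιCl (Q.twist i (E.dual a)) * Q.ιCl (Q.twist i (Q.bracket (E.e a) z)) =
      E.moment (Q.twist i z) := by
    rw [moment_apply]
    simp only [Q.twist_bracket]
    exact E.sum_twist_twist (fun u v => Q.ιCl u * Q.ιCl (Q.bracket v (Q.twist i z))) i
  have h2 : ∑ a, Q.form x (Q.bracket (E.e a) z) • Q.twist i (E.dual a) = -Q.bracket x z := by
    have hb (a) : Q.form x (Q.bracket (E.e a) z) =
        Q.form (E.e a) (Q.twist i (Q.bracket (Q.twist i z) x)) := by
      rw [Q.form_twist hx, Q.twist_bracket, Q.invariant, Q.form_twist_left]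
    simp only [hb, ← map_smul, ← map_sum]
    rw [← E.eq_sum_form_e, Q.twist_twist, Q.skew_twist hx, neg_neg]
  have h3 : ∑ a, Q.form x (E.dual a) • Q.bracket (E.e a) z = Q.bracket x z := by
    conv_rhs => rw [E.eq_sum_form_dual x]
    simp
  have key (a) : Q.ιCl x * (Q.ιCl (E.dual a) * Q.ιCl (Q.bracket (E.e a) z)) =
      Q.ιCl (Q.twist i (E.dual a)) * Q.ιCl (Q.twist i (Q.bracket (E.e a) z)) * Q.ιCl x
      - (2 : ℂ) • Q.ιCl (Q.form x (Q.bracket (E.e a) z) • Q.twist i (E.dual a))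
      + (2 : ℂ) • Q.ιCl (Q.form x (E.dual a) • Q.bracket (E.e a) z) := by
    rw [← mul_assoc, Q.ιCl_mul_twist hx, add_mul, neg_mul, mul_assoc, Q.ιCl_mul_twist hx, mul_add,
      smul_mul_assoc, one_mul, mul_smul_comm, mul_one, map_smul, map_smul, smul_smul, smul_smul]
    simp only [mul_neg, mul_assoc]
    abel
  rw [moment_apply, Finset.mul_sum]
  simp only [key]
  rw [Finset.sum_add_distrib, Finset.sum_sub_distrib, ← Finset.sum_mul, h1, ← Finset.smul_sum,
    ← Finset.smul_sum, ← map_sum, ← map_sum, h2, h3, map_neg]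
  module

/-- The element `∑ e^a e^b [e_b, e_a]` of the Clifford algebra. -/
def cubicSum : Q.Cl := ∑ a, Q.ιCl (E.dual a) * E.moment (E.e a)

/-- The constant is `2 + 4`: contracting `x` with `e^a` gives `2 μ(x)`, and passing it through
`μ(e_a)` gives `4 μ(x)`. No sign depends on `x` because `C` is even for the parity and cubic in the
generators. -/
theorem ιCl_mul_cubicSum (x : g) :
    Q.ιCl x * E.cubicSum = -(E.cubicSum * Q.ιCl x) + (6 : ℂ) • E.moment x := by
  have : (LinearMap.mul ℂ Q.Cl).flip E.cubicSum ∘ₗ Q.ιCl =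
      -(LinearMap.mul ℂ Q.Cl E.cubicSum ∘ₗ Q.ιCl) + (6 : ℂ) • E.moment := by
    apply Q.hom_ext
    intro i x hx
    have h1 : ∑ a, Q.ιCl (Q.twist i (E.dual a)) * E.moment (Q.twist i (E.e a)) = E.cubicSum :=
      E.sum_twist_twist (fun u v => Q.ιCl u * E.moment v) i
    have h2 : ∑ a, Q.ιCl (Q.twist i (E.dual a)) * Q.ιCl (Q.bracket x (E.e a)) = -E.moment x := by
      rw [moment_apply]
      simp only [Q.skew_twist hx, map_neg, mul_neg, Finset.sum_neg_distrib, neg_inj]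
      exact E.sum_twist_twist (fun u v => Q.ιCl u * Q.ιCl (Q.bracket v x)) i
    have h3 : ∑ a, Q.form x (E.dual a) • E.moment (E.e a) = E.moment x := by
      conv_rhs => rw [E.eq_sum_form_dual x]
      simp
    have key (a) : Q.ιCl x * (Q.ιCl (E.dual a) * E.moment (E.e a)) =
        -(Q.ιCl (Q.twist i (E.dual a)) * E.moment (Q.twist i (E.e a)) * Q.ιCl x)
        - (4 : ℂ) • (Q.ιCl (Q.twist i (E.dual a)) * Q.ιCl (Q.bracket x (E.e a)))
        + (2 : ℂ) • Q.form x (E.dual a) • E.moment (E.e a) := by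
      rw [← mul_assoc, Q.ιCl_mul_twist hx, add_mul, neg_mul, mul_assoc, E.ιCl_mul_moment hx,
        mul_add, smul_mul_assoc, one_mul, mul_smul_comm, smul_smul, mul_assoc]
      abel
    have : Q.ιCl x * E.cubicSum = -(E.cubicSum * Q.ιCl x) + (6 : ℂ) • E.moment x := by
      conv_lhs => rw [cubicSum]
      rw [Finset.mul_sum]
      simp only [key]
      rw [Finset.sum_add_distrib, Finset.sum_sub_distrib, Finset.sum_neg_distrib,
        ← Finset.sum_mul, h1, ← Finset.smul_sum, ← Finset.smul_sum, h2, h3]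
      module
    simpa using this
  simpa using DFunLike.congr_fun this x

/-- The action `z ↦ ∑ [e^a, [e_a, z]]` of the Casimir element. -/
def casimirAd : g →ₗ[ℂ] g := ∑ a, Q.bracket (E.dual a) ∘ₗ Q.bracket (E.e a)

theorem casimirAd_apply (z : g) :
    E.casimirAd z = ∑ a, Q.bracket (E.dual a) (Q.bracket (E.e a) z) := by
  simp [casimirAd]

theorem casimirAd_apply' (z : g) :
    E.casimirAd z = ∑ a, Q.bracket (Q.bracket z (E.dual a)) (E.e a) := by
  rw [casimirAd_apply]
  exact (E.sum_bracket (fun x y => Q.bracket x y) z).symm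

theorem adU_casimir : Q.adU (Q.casimir E) = E.casimirAd := by
  have h (x : g) : Q.adU (Q.ιU x) = Q.bracket x := Q.liftU_ιU _ _ x
  simp only [casimir, map_sum, map_mul, h, casimirAd]
  rfl

theorem casimirAd_mem {j : ZMod 2} {z : g} (hz : z ∈ Q.part j) : E.casimirAd z ∈ Q.part j := by
  rw [casimirAd_apply]
  refine Submodule.sum_mem _ fun a _ => ?_
  have := Q.bracket_mem (E.dual_mem a) (Q.bracket_mem (E.e_mem a) hz)
  rwa [← add_assoc, CharTwo.add_self_eq_zero, zero_add] at this

theorem form_casimirAd (x y : g) : Q.form (E.casimirAd x) y = Q.form x (E.casimirAd y) := by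
  rw [casimirAd_apply', casimirAd_apply]
  simp [Q.invariant]

/-- The coordinates of a vector are its pairings `B(·, e^a)`; exchanging the arguments of `B` uses
up the parity operator in the supertrace. -/
theorem str_eq_sum (T : Module.End ℂ g) : Q.str T = ∑ a, Q.form (E.dual a) (T (E.e a)) := by
  classical
  rw [LieSuperalgebra.str, LinearMap.trace_eq_matrix_trace ℂ E.e, Matrix.trace]
  refine Finset.sum_congr rfl fun a _ => ?_
  have h (x : g) : E.e.repr x a = Q.form x (E.dual a) := by
    conv_lhs => rw [E.eq_sum_form_dual x]
    simp [Finsupp.single_apply]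
  rw [Matrix.diag_apply, LinearMap.toMatrix_apply, h, Q.form_symm (E.dual a)]
  rfl

end DualBases

end QuadraticLieSuperalgebra

/-! ### The Jacobi identity in the Clifford algebra and the square of the cubic element -/

namespace QuadraticLieSuperalgebra

variable {g : Type*} [AddCommGroup g] [Module ℂ g] (Q : QuadraticLieSuperalgebra g)

theorem ιCl_mul_sgn {i j : ZMod 2} {x y : g} (hx : x ∈ Q.part i) (hy : y ∈ Q.part j) :
    Q.ιCl x * Q.ιCl y =
      -(sgn (i * j) • (Q.ιCl y * Q.ιCl x)) + (2 * Q.form x y) • (1 : Q.Cl) := by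
  rw [Q.ιCl_mul_twist hx, Q.twist_of_mem hy, map_smul, smul_mul_assoc]

namespace DualBases

variable {Q} {n : Type*} [Fintype n] (E : Q.DualBases n)

/-- The element `∑ μ(e^b) [e_b, z]` of the Clifford algebra, where `μ` is `moment`. -/
def quartic (z : g) : Q.Cl := ∑ b, E.moment (E.dual b) * Q.ιCl (Q.bracket (E.e b) z)

theorem sum_dual_mul_moment_bracket (z : g) :
    ∑ b, Q.ιCl (E.dual b) * E.moment (Q.bracket (E.e b) z) =
      ∑ b, Q.ιCl (Q.bracket z (E.dual b)) * E.moment (E.e b) :=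
  (E.sum_bracket (fun x y => Q.ιCl x * E.moment y) z).symm

/-- Passing `[z, e^b]` through `μ(e_b)` leaves `4 [[z, e^b], e_b]`, a Casimir term; supersymmetry of
the canonical tensor identifies the reordered sum with `quartic`. -/
theorem sum_bracket_mul_moment {j : ZMod 2} {z : g} (hz : z ∈ Q.part j) :
    ∑ b, Q.ιCl (Q.bracket z (E.dual b)) * E.moment (E.e b) =
      -E.quartic z + (4 : ℂ) • Q.ιCl (E.casimirAd z) := by
  have key (b) : Q.ιCl (Q.bracket z (E.dual b)) * E.moment (E.e b) =
      -(sgn (E.p b) • (E.moment (E.e b) * Q.ιCl (Q.bracket (E.dual b) z))) +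
        (4 : ℂ) • Q.ιCl (Q.bracket (Q.bracket z (E.dual b)) (E.e b)) := by
    rw [E.ιCl_mul_moment (Q.bracket_mem hz (E.dual_mem b)), Q.twist_of_mem (E.e_mem b),
      map_smul, Q.skew_sgn hz (E.dual_mem b)]
    congr 1
    rcases zmod_two_cases j with rfl | rfl <;> rcases zmod_two_cases (E.p b) with hp | hp <;>
      simp [hp, zmod_two_one_add_one]
  simp only [key]
  rw [Finset.sum_add_distrib, Finset.sum_neg_distrib, ← Finset.smul_sum, ← map_sum,
    ← casimirAd_apply', quartic]
  congr 2
  exact (E.sum_flip (fun x y => E.moment x * Q.ιCl (Q.bracket y z))).symm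

/-- Expand `quartic z` as `∑ e^a [e_a, [z, e^b]] e_b` and apply Jacobi to the middle factor. With `q
= quartic z` and `c = Cas(z)`, the two resulting sums are `-q + 4c` and `-q + 2c`, whence `3q = 6c`.
-/
theorem quartic_eq {j : ZMod 2} {z : g} (hz : z ∈ Q.part j) :
    E.quartic z = (2 : ℂ) • Q.ιCl (E.casimirAd z) := by
  have hN := E.sum_bracket_mul_moment hz
  have h1 : E.quartic z = ∑ b, ∑ a, Q.ιCl (E.dual a) *
      Q.ιCl (Q.bracket (E.e a) (Q.bracket z (E.dual b))) * Q.ιCl (E.e b) := by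
    rw [quartic, ← E.sum_bracket (fun x y => E.moment x * Q.ιCl y) z]
    simp only [moment_apply, Finset.sum_mul]
  have h2 : ∑ b, ∑ a, Q.ιCl (E.dual a) *
      Q.ιCl (Q.bracket (Q.bracket (E.e a) z) (E.dual b)) * Q.ιCl (E.e b) =
      -E.quartic z + (4 : ℂ) • Q.ιCl (E.casimirAd z) := by
    rw [← hN, ← sum_dual_mul_moment_bracket, Finset.sum_comm]
    simp only [moment_apply', Finset.mul_sum, mul_assoc]
  have h3 : ∑ b, ∑ a, Q.ιCl (E.dual a) *
      Q.ιCl (sgn (E.p a * j) • Q.bracket z (Q.bracket (E.e a) (E.dual b))) * Q.ιCl (E.e b) =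
      -E.quartic z + (2 : ℂ) • Q.ιCl (E.casimirAd z) := by
    have e1 : ∑ b, ∑ a, Q.ιCl (E.dual a) *
        Q.ιCl (sgn (E.p a * j) • Q.bracket z (Q.bracket (E.e a) (E.dual b))) * Q.ιCl (E.e b) =
        -- Invariance moves `ad e_a` to the last factor. Exchanging the first two factors afterwards
        -- recovers `∑ [z, e^b] μ(e_b)` plus a contraction.
        ∑ b, ∑ a, Q.ιCl (E.dual a) * Q.ιCl (sgn (E.p a * j) • Q.bracket z (E.dual b)) *
          Q.ιCl (Q.bracket (E.e b) (E.e a)) := by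
      rw [Finset.sum_comm]
      conv_rhs => rw [Finset.sum_comm]
      refine Finset.sum_congr rfl fun a _ => ?_
      exact E.sum_bracket (fun x y => Q.ιCl (E.dual a) *
        Q.ιCl (sgn (E.p a * j) • Q.bracket z x) * Q.ιCl y) (E.e a)
    have e2 (b a) : Q.ιCl (E.dual a) * Q.ιCl (sgn (E.p a * j) • Q.bracket z (E.dual b)) *
          Q.ιCl (Q.bracket (E.e b) (E.e a)) =
        Q.ιCl (Q.bracket z (E.dual b)) * (Q.ιCl (E.dual a) * Q.ιCl (Q.bracket (E.e a) (E.e b)))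
        + (2 : ℂ) • Q.ιCl (Q.bracket (E.e b) (Q.form (Q.twist (1 + j)
            (Q.bracket z (E.dual b))) (E.dual a) • E.e a)) := by
      have hw := Q.bracket_mem hz (E.dual_mem b)
      rw [map_smul, mul_smul_comm, Q.ιCl_mul_sgn (E.dual_mem a) hw, Q.twist_of_mem hw,
        Q.skew_sgn (E.e_mem a) (E.e_mem b), Q.form_symm_left (E.dual_mem a)]
      simp only [map_smul, map_neg, LinearMap.smul_apply]
      generalize Q.bracket (E.e b) (E.e a) = v at *
      -- The two signs in `e5` agree only when the parities match; otherwise consistency of `B`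
      -- kills the contraction.
      have hB : E.p a = j + E.p b ∨ Q.form (Q.bracket z (E.dual b)) (E.dual a) = 0 :=
        or_iff_not_imp_left.2 fun h => Q.form_eq_zero hw (E.dual_mem a) (Ne.symm h)
      generalize Q.form (Q.bracket z (E.dual b)) (E.dual a) = t at *
      have e4 : (sgn (E.p a * j) * sgn (E.p a * (j + E.p b))) = sgn (E.p a * E.p b) := by
        rw [← sgn_add, mul_add, ← add_assoc, CharTwo.add_self_eq_zero, zero_add]
      have e5 : sgn (E.p a * j) * (sgn (E.p a) * t) = sgn ((1 + j) * (j + E.p b)) * t := by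
        rcases hB with hB | rfl
        · rw [← mul_assoc, ← sgn_add, ← hB]
          congr 2
          ring
        · simp
      rw [smul_mul_assoc, add_mul, neg_mul, smul_add, smul_neg, smul_mul_assoc, smul_smul, e4,
        smul_mul_assoc, smul_smul, one_mul, mul_left_comm, e5, mul_neg, mul_neg, mul_smul_comm,
        mul_smul_comm, mul_assoc, smul_smul, smul_eq_mul]
    rw [e1]
    simp only [e2, Finset.sum_add_distrib, ← Finset.mul_sum, ← Finset.smul_sum, ← map_sum]
    simp only [← moment_apply, ← E.eq_sum_form_dual]
    rw [hN]
    have e3 (b) : Q.bracket (E.e b) (Q.twist (1 + j) (Q.bracket z (E.dual b))) =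
        - Q.bracket (Q.bracket z (E.dual b)) (E.e b) := by
      have hw := Q.bracket_mem hz (E.dual_mem b)
      rw [Q.twist_of_mem hw, map_smul, Q.skew_sgn (E.e_mem b) hw]
      rcases zmod_two_cases j with rfl | rfl <;> rcases zmod_two_cases (E.p b) with hp | hp <;>
        simp [hp, zmod_two_one_add_one]
    simp only [e3, Finset.sum_neg_distrib, ← casimirAd_apply']
    rw [map_neg]
    module
  have h4 : E.quartic z = -E.quartic z + (4 : ℂ) • Q.ιCl (E.casimirAd z) +
      (-E.quartic z + (2 : ℂ) • Q.ιCl (E.casimirAd z)) := by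
    rw [← h2, ← h3]
    simp only [← Finset.sum_add_distrib]
    conv_lhs => rw [h1]
    refine Finset.sum_congr rfl fun b _ => Finset.sum_congr rfl fun a _ => ?_
    rw [Q.jacobi_sgn (E.e_mem a) hz, map_add, mul_add, add_mul]
  have h5 : (3 : ℂ) • E.quartic z = (3 : ℂ) • (2 : ℂ) • Q.ιCl (E.casimirAd z) := by
    have : (3 : ℂ) • E.quartic z = E.quartic z + (2 : ℂ) • E.quartic z := by module
    rw [this]
    nth_rewrite 1 [h4]
    module
  exact smul_right_injective _ (by norm_num : (3 : ℂ) ≠ 0) h5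

/-- Two anticommutations with `C` leave six times the difference of `quartic z` and `∑ e^b μ([e_b,
z])`; both equal `2 Cas(z)`. -/
theorem cubicSum_mul_moment {j : ZMod 2} {z : g} (hz : z ∈ Q.part j) :
    E.cubicSum * E.moment z = E.moment z * E.cubicSum := by
  have h (x) : E.cubicSum * Q.ιCl x = -(Q.ιCl x * E.cubicSum) + (6 : ℂ) • E.moment x := by
    rw [E.ιCl_mul_cubicSum]; abel
  have key (b) : E.cubicSum * (Q.ιCl (E.dual b) * Q.ιCl (Q.bracket (E.e b) z)) =
      Q.ιCl (E.dual b) * Q.ιCl (Q.bracket (E.e b) z) * E.cubicSum +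
      (6 : ℂ) • (E.moment (E.dual b) * Q.ιCl (Q.bracket (E.e b) z)) -
      (6 : ℂ) • (Q.ιCl (E.dual b) * E.moment (Q.bracket (E.e b) z)) := by
    rw [← mul_assoc, h, add_mul, neg_mul, mul_assoc, h, mul_add, mul_smul_comm, smul_mul_assoc,
      mul_neg, mul_assoc]
    abel
  conv_lhs => rw [moment_apply, Finset.mul_sum]
  simp only [key]
  rw [Finset.sum_sub_distrib, Finset.sum_add_distrib, ← Finset.sum_mul, ← moment_apply,
    ← Finset.smul_sum, ← Finset.smul_sum, sum_dual_mul_moment_bracket,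
    E.sum_bracket_mul_moment hz, ← quartic, E.quartic_eq hz]
  module

theorem cubicSum_mul_cubicSum :
    E.cubicSum * E.cubicSum = (6 * Q.str (Q.adU (Q.casimir E))) • (1 : Q.Cl) := by
  have h (x) : E.cubicSum * Q.ιCl x = -(Q.ιCl x * E.cubicSum) + (6 : ℂ) • E.moment x := by
    rw [E.ιCl_mul_cubicSum]; abel
  have h1 : E.cubicSum * E.cubicSum = -(E.cubicSum * E.cubicSum) +
      (6 : ℂ) • ∑ a, E.moment (E.dual a) * E.moment (E.e a) := by
    have key (a) : E.cubicSum * (Q.ιCl (E.dual a) * E.moment (E.e a)) =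
        -(Q.ιCl (E.dual a) * E.moment (E.e a) * E.cubicSum) +
          (6 : ℂ) • (E.moment (E.dual a) * E.moment (E.e a)) := by
      rw [← mul_assoc, h, add_mul, neg_mul, mul_assoc, E.cubicSum_mul_moment (E.e_mem a),
        smul_mul_assoc, mul_assoc]
    have : E.cubicSum * E.cubicSum = ∑ a, E.cubicSum * (Q.ιCl (E.dual a) * E.moment (E.e a)) := by
      rw [← Finset.mul_sum, ← cubicSum]
    refine this.trans ?_
    simp only [key]
    rw [Finset.sum_add_distrib, Finset.sum_neg_distrib, ← Finset.sum_mul, ← Finset.smul_sum,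
      ← cubicSum]
  -- Expanding only the second moment and summing over `a` first exhibits `quartic (e^b)` as a left
  -- factor of `e_b`.
  have h2 : ∑ a, E.moment (E.dual a) * E.moment (E.e a) =
      (2 : ℂ) • ∑ b, Q.ιCl (E.casimirAd (E.dual b)) * Q.ιCl (E.e b) := by
    have h4 (a) : E.moment (E.e a) =
        ∑ b, Q.ιCl (Q.bracket (E.e a) (E.dual b)) * Q.ιCl (E.e b) := E.moment_apply' _
    simp only [h4, Finset.mul_sum]
    rw [Finset.sum_comm, Finset.smul_sum]
    refine Finset.sum_congr rfl fun b _ => ?_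
    rw [← smul_mul_assoc, ← E.quartic_eq (E.dual_mem b), quartic, Finset.sum_mul]
    simp only [mul_assoc]
  -- Since the Casimir is self-adjoint, the tensor `∑ Cas(e^b) ⊗ e_b` is supersymmetric, so the
  -- Clifford relation turns the sum `S` into `-S` plus twice the supertrace.
  have h3 : ∑ b, Q.ιCl (E.casimirAd (E.dual b)) * Q.ιCl (E.e b) =
      Q.str (Q.adU (Q.casimir E)) • (1 : Q.Cl) := by
    have key (b) : Q.ιCl (E.casimirAd (E.dual b)) * Q.ιCl (E.e b) =
        -(sgn (E.p b) • (Q.ιCl (E.e b) * Q.ιCl (E.casimirAd (E.dual b)))) +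
          (2 * Q.form (E.dual b) (E.casimirAd (E.e b))) • (1 : Q.Cl) := by
      rw [Q.ιCl_mul_sgn (E.casimirAd_mem (E.dual_mem b)) (E.e_mem b), E.form_casimirAd]
      rcases zmod_two_cases (E.p b) with hp | hp <;> simp [hp]
    have h5 : ∑ b, Q.ιCl (E.casimirAd (E.dual b)) * Q.ιCl (E.e b) =
        ∑ b, sgn (E.p b) • (Q.ιCl (E.e b) * Q.ιCl (E.casimirAd (E.dual b))) := by
      rw [E.sum_adjoint (fun x y => Q.ιCl x * Q.ιCl y) E.form_casimirAd]
      exact E.sum_flip (fun x y => Q.ιCl x * Q.ιCl (E.casimirAd y))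
    have h6 : ∑ b, Q.ιCl (E.casimirAd (E.dual b)) * Q.ιCl (E.e b) =
        -∑ b, Q.ιCl (E.casimirAd (E.dual b)) * Q.ιCl (E.e b) +
          (2 * Q.str (Q.adU (Q.casimir E))) • (1 : Q.Cl) := by
      conv_rhs => rw [h5]
      rw [Finset.sum_congr rfl fun b _ => key b, Finset.sum_add_distrib, Finset.sum_neg_distrib,
        ← Finset.sum_smul, ← Finset.mul_sum, adU_casimir, E.str_eq_sum]
    rw [eq_neg_add_iff_add_eq, ← two_smul ℂ, mul_smul] at h6
    exact smul_right_injective _ (two_ne_zero (α := ℂ)) h6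
  rw [eq_neg_add_iff_add_eq, ← two_smul ℂ, h2, h3] at h1
  refine smul_right_injective _ (two_ne_zero (α := ℂ)) (h1.trans ?_)
  module

end DualBases

end QuadraticLieSuperalgebra

/-! ### Quantization of the Cartan cubic form -/

namespace QuadraticLieSuperalgebra

variable {g : Type*} [AddCommGroup g] [Module ℂ g] (Q : QuadraticLieSuperalgebra g)

theorem univ_perm_fin_three : (Finset.univ : Finset (Equiv.Perm (Fin 3))) =
    {1, Equiv.swap 0 1, Equiv.swap 1 2, Equiv.swap 0 2, Equiv.swap 0 1 * Equiv.swap 1 2,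
      Equiv.swap 1 2 * Equiv.swap 0 1} := by decide

theorem permSign_one (p : Fin 3 → ZMod 2) : permSign p 1 = 1 := by
  rw [permSign, show (Finset.univ.filter fun ij : Fin 3 × Fin 3 => ij.1 < ij.2 ∧
    (1 : Equiv.Perm (Fin 3))⁻¹ ij.2 < (1 : Equiv.Perm (Fin 3))⁻¹ ij.1) = ∅ by decide]
  simp

theorem permSign_swap_zero_one (p : Fin 3 → ZMod 2) :
    permSign p (Equiv.swap 0 1) = -(-1) ^ (p 0 * p 1) := by
  rw [permSign, show (Finset.univ.filter fun ij : Fin 3 × Fin 3 => ij.1 < ij.2 ∧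
    (Equiv.swap 0 1 : Equiv.Perm (Fin 3))⁻¹ ij.2 < (Equiv.swap 0 1 : Equiv.Perm (Fin 3))⁻¹ ij.1) =
      {(0, 1)} by decide, show Equiv.Perm.sign (Equiv.swap 0 1 : Equiv.Perm (Fin 3)) = -1 by decide]
  simp

theorem permSign_swap_one_two (p : Fin 3 → ZMod 2) :
    permSign p (Equiv.swap 1 2) = -(-1) ^ (p 1 * p 2) := by
  rw [permSign, show (Finset.univ.filter fun ij : Fin 3 × Fin 3 => ij.1 < ij.2 ∧
    (Equiv.swap 1 2 : Equiv.Perm (Fin 3))⁻¹ ij.2 < (Equiv.swap 1 2 : Equiv.Perm (Fin 3))⁻¹ ij.1) =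
      {(1, 2)} by decide, show Equiv.Perm.sign (Equiv.swap 1 2 : Equiv.Perm (Fin 3)) = -1 by decide]
  simp

theorem permSign_swap_zero_two (p : Fin 3 → ZMod 2) :
    permSign p (Equiv.swap 0 2) = -(-1) ^ (p 0 * p 1 + p 0 * p 2 + p 1 * p 2) := by
  rw [permSign, show (Finset.univ.filter fun ij : Fin 3 × Fin 3 => ij.1 < ij.2 ∧
    (Equiv.swap 0 2 : Equiv.Perm (Fin 3))⁻¹ ij.2 < (Equiv.swap 0 2 : Equiv.Perm (Fin 3))⁻¹ ij.1) =
      {(0, 1), (0, 2), (1, 2)} by decide,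
    show Equiv.Perm.sign (Equiv.swap 0 2 : Equiv.Perm (Fin 3)) = -1 by decide]
  simp [uzpow_add, mul_assoc]

theorem permSign_cycle (p : Fin 3 → ZMod 2) :
    permSign p (Equiv.swap 0 1 * Equiv.swap 1 2) = (-1) ^ (p 0 * p 1 + p 0 * p 2) := by
  rw [permSign, show (Finset.univ.filter fun ij : Fin 3 × Fin 3 => ij.1 < ij.2 ∧
    (Equiv.swap 0 1 * Equiv.swap 1 2 : Equiv.Perm (Fin 3))⁻¹ ij.2 <
      (Equiv.swap 0 1 * Equiv.swap 1 2 : Equiv.Perm (Fin 3))⁻¹ ij.1) = {(0, 1), (0, 2)} by decide,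
    show Equiv.Perm.sign (Equiv.swap 0 1 * Equiv.swap 1 2 : Equiv.Perm (Fin 3)) = 1 by decide]
  simp [uzpow_add]

theorem permSign_cycle_inv (p : Fin 3 → ZMod 2) :
    permSign p (Equiv.swap 1 2 * Equiv.swap 0 1) = (-1) ^ (p 0 * p 2 + p 1 * p 2) := by
  rw [permSign, show (Finset.univ.filter fun ij : Fin 3 × Fin 3 => ij.1 < ij.2 ∧
    (Equiv.swap 1 2 * Equiv.swap 0 1 : Equiv.Perm (Fin 3))⁻¹ ij.2 <
      (Equiv.swap 1 2 * Equiv.swap 0 1 : Equiv.Perm (Fin 3))⁻¹ ij.1) = {(0, 2), (1, 2)} by decide,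
    show Equiv.Perm.sign (Equiv.swap 1 2 * Equiv.swap 0 1 : Equiv.Perm (Fin 3)) = 1 by decide]
  simp [uzpow_add]

theorem quantize_three (p q r : ZMod 2) (x y z : g) :
    Q.quantize ![p, q, r] ![x, y, z] = (1 / 6 : ℂ) •
      (Q.ιCl x * Q.ιCl y * Q.ιCl z - sgn (p * q) • (Q.ιCl y * Q.ιCl x * Q.ιCl z)
        - sgn (q * r) • (Q.ιCl x * Q.ιCl z * Q.ιCl y)
        - sgn (p * q + p * r + q * r) • (Q.ιCl z * Q.ιCl y * Q.ιCl x)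
        + sgn (p * q + p * r) • (Q.ιCl y * Q.ιCl z * Q.ιCl x)
        + sgn (p * r + q * r) • (Q.ιCl z * Q.ιCl x * Q.ιCl y)) := by
  rw [quantize, univ_perm_fin_three, Finset.sum_insert (by decide), Finset.sum_insert (by decide),
    Finset.sum_insert (by decide), Finset.sum_insert (by decide), Finset.sum_insert (by decide),
    Finset.sum_singleton, permSign_one, permSign_swap_zero_one, permSign_swap_one_two,
    permSign_swap_zero_two, permSign_cycle, permSign_cycle_inv]
  have e1 : (Equiv.swap 0 1 : Equiv.Perm (Fin 3)) 2 = 2 := by decide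
  have e2 : (Equiv.swap 1 2 : Equiv.Perm (Fin 3)) 0 = 0 := by decide
  have e3 : (Equiv.swap 0 2 : Equiv.Perm (Fin 3)) 1 = 1 := by decide
  simp only [Units.neg_smul, units_smul_eq_sgn, List.ofFn_succ, List.ofFn_zero, List.prod_cons,
    List.prod_nil, Equiv.Perm.mul_apply]
  simp [e1, e2, e3, Nat.factorial, mul_assoc, sgn_add]
  module

namespace DualBases

variable {Q} {n : Type*} [Fintype n] (E : Q.DualBases n)

/-- The coefficients of the Cartan cubic form. -/
def coeff (a b c : n) : ℂ :=
  sgn (E.p a * E.p b + E.p c) * Q.form (Q.bracket (E.e a) (E.e b)) (E.e c)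

omit [Fintype n] in
theorem coeff_swap_left (a b c : n) : E.coeff b a c = -(sgn (E.p a * E.p b) * E.coeff a b c) := by
  rw [coeff, coeff, Q.skew_sgn (E.e_mem b) (E.e_mem a), mul_comm (E.p b)]
  simp
  ring

omit [Fintype n] in
-- Invariance reduces this to skew-symmetry of `[e_b, e_c]`. The signs agree when `p_a = p_b + p_c`,
-- and otherwise the coefficient vanishes.
theorem coeff_swap_right (a b c : n) :
    E.coeff a c b = -(sgn (E.p b * E.p c) * E.coeff a b c) := by
  rw [coeff, coeff, Q.invariant, Q.invariant, Q.skew_sgn (E.e_mem c) (E.e_mem b)]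
  by_cases h : E.p a = E.p b + E.p c
  · rw [h]
    rcases zmod_two_cases (E.p b) with hb | hb <;> rcases zmod_two_cases (E.p c) with hc | hc <;>
      simp [hb, hc, zmod_two_one_add_one]
  · rw [map_neg, map_smul, Q.form_eq_zero (E.e_mem a) (Q.bracket_mem (E.e_mem b) (E.e_mem c)) h]
    simp

/-- Summing over `c` reassembles `-[e_b, e_a]` from its coordinates; the sign in the definition of
`φ` is exactly the one that this needs. -/
theorem sum_coeff : ∑ a, ∑ b, ∑ c, E.coeff a b c •
    (Q.ιCl (E.dual a) * Q.ιCl (E.dual b) * Q.ιCl (E.dual c)) = -E.cubicSum := by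
  have h (a b) : ∑ c, E.coeff a b c • Q.ιCl (E.dual c) =
      -Q.ιCl (Q.bracket (E.e b) (E.e a)) := by
    conv_rhs => rw [E.eq_sum_form_e (Q.bracket (E.e b) (E.e a)), map_sum]
    rw [← Finset.sum_neg_distrib]
    refine Finset.sum_congr rfl fun c _ => ?_
    rw [coeff, Q.form_symm_left (E.e_mem c), Q.skew_sgn (E.e_mem b) (E.e_mem a), map_smul,
      ← neg_smul, sgn_add, mul_comm (E.p b)]
    congr 1
    simp
    ring
  rw [cubicSum, ← Finset.sum_neg_distrib]
  refine Finset.sum_congr rfl fun a _ => ?_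
  rw [moment_apply, Finset.mul_sum, ← Finset.sum_neg_distrib]
  refine Finset.sum_congr rfl fun b _ => ?_
  rw [← mul_assoc, ← mul_neg, ← h, Finset.mul_sum]
  simp

/-- The permutation signs of the quantization cancel those of the super-antisymmetric coefficients.
The six terms are therefore relabellings of one sum, equal to `-C`. -/
theorem cubic_eq : Q.cubic E = (1 / 12 : ℂ) • E.cubicSum := by
  have h1 : Q.cubic E = (-(1 / 12) : ℂ) • ∑ a, ∑ b, ∑ c, E.coeff a b c •
      Q.quantize ![E.p a, E.p b, E.p c] ![E.dual a, E.dual b, E.dual c] := by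
    rw [cubic]
    simp only [units_smul_eq_sgn, coeff, smul_eq_mul]
  set f : n → n → n → Q.Cl := fun a b c => E.coeff a b c •
    (Q.ιCl (E.dual a) * Q.ιCl (E.dual b) * Q.ιCl (E.dual c)) with hf
  have h2 (a b c) : E.coeff a b c •
      Q.quantize ![E.p a, E.p b, E.p c] ![E.dual a, E.dual b, E.dual c] =
      (1 / 6 : ℂ) • (f a b c + f b a c + f a c b + f c b a + f b c a + f c a b) := by
    have e1 : E.coeff b a c = -(sgn (E.p a * E.p b) * E.coeff a b c) := E.coeff_swap_left a b c
    have e2 : E.coeff a c b = -(sgn (E.p b * E.p c) * E.coeff a b c) := E.coeff_swap_right a b c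
    have e3 := E.coeff_swap_right b a c
    have e4 := E.coeff_swap_left a c b
    have e5 := E.coeff_swap_left b c a
    rw [Q.quantize_three]
    simp only [hf, e5, e4, e3, e2, e1, sgn_add]
    module
  rw [h1]
  simp only [h2]
  have s1 (k : n → n → n → Q.Cl) : ∑ a, ∑ b, ∑ c, k b a c = ∑ a, ∑ b, ∑ c, k a b c :=
    Finset.sum_comm
  have s2 (k : n → n → n → Q.Cl) : ∑ a, ∑ b, ∑ c, k a c b = ∑ a, ∑ b, ∑ c, k a b c :=
    Finset.sum_congr rfl fun a _ => Finset.sum_comm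
  have s4 (k : n → n → n → Q.Cl) : ∑ a, ∑ b, ∑ c, k c a b = ∑ a, ∑ b, ∑ c, k a b c :=
    (s2 fun a b c => k b a c).trans (s1 k)
  have s3 (k : n → n → n → Q.Cl) : ∑ a, ∑ b, ∑ c, k b c a = ∑ a, ∑ b, ∑ c, k a b c :=
    (s4 fun a b c => k b c a).symm
  have s5 (k : n → n → n → Q.Cl) : ∑ a, ∑ b, ∑ c, k c b a = ∑ a, ∑ b, ∑ c, k a b c :=
    (s4 fun a b c => k a c b).trans (s2 k)
  simp only [← Finset.smul_sum, Finset.sum_add_distrib, s1 f, s2 f, s3 f, s4 f, s5 f]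
  rw [E.sum_coeff]
  module

/-- `moment` and `cubicSum` are compatible with parity. -/
theorem parityCl_moment (z : g) : Q.parityCl (E.moment z) = E.moment (Q.parity z) := by
  rw [moment_apply, moment_apply, map_sum]
  simp only [map_mul, Q.parityCl_ιCl, ← Q.twist_one, Q.twist_bracket]
  exact E.sum_twist_twist (fun x y => Q.ιCl x * Q.ιCl (Q.bracket y (Q.twist 1 z))) 1

theorem parityCl_cubicSum : Q.parityCl E.cubicSum = E.cubicSum := by
  rw [cubicSum, map_sum]
  simp only [map_mul, Q.parityCl_ιCl, E.parityCl_moment, ← Q.twist_one]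
  exact E.sum_twist_twist (fun x y => Q.ιCl x * E.moment y) 1

end DualBases

end QuadraticLieSuperalgebra

/-! ### The square of the cubic Dirac operator -/

namespace QuadraticLieSuperalgebra

variable {g : Type*} [AddCommGroup g] [Module ℂ g] (Q : QuadraticLieSuperalgebra g)

theorem ιU_mem_gradingU {i : ZMod 2} {x : g} (hx : x ∈ Q.part i) : Q.ιU x ∈ Q.gradingU i := by
  rw [mem_parityGrading, Q.parityU_ιU, Q.parity_of_mem hx, units_smul_eq_sgn, units_smul_eq_sgn,
    map_smul]

theorem ιCl_mem_gradingCl {i : ZMod 2} {x : g} (hx : x ∈ Q.part i) :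
    Q.ιCl x ∈ Q.gradingCl i := by
  rw [mem_parityGrading, Q.parityCl_ιCl, Q.parity_of_mem hx, units_smul_eq_sgn, units_smul_eq_sgn,
    map_smul]

/-- The bilinear map `(u, c) ↦ u ⊗ c` into `U(g) ⊗ Cl(g)`. -/
def tmulW : Q.U →ₗ[ℂ] Q.Cl →ₗ[ℂ] Q.W :=
  (TensorProduct.mk ℂ Q.U Q.Cl).compr₂
    (GradedTensorProduct.of ℂ Q.gradingU Q.gradingCl).toLinearMap

theorem tmulW_apply (u : Q.U) (c : Q.Cl) : Q.tmulW u c = GradedTensorProduct.tmul ℂ u c := rfl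

theorem tmulW_mul {i j : ZMod 2} {u v : Q.U} {c d : Q.Cl} (hc : c ∈ Q.gradingCl i)
    (hv : v ∈ Q.gradingU j) :
    Q.tmulW u c * Q.tmulW v d = sgn (i * j) • Q.tmulW (u * v) (c * d) := by
  have := GradedTensorProduct.tmul_coe_mul_coe_tmul (R := ℂ) (𝒜 := Q.gradingU) (ℬ := Q.gradingCl)
    u ⟨c, hc⟩ ⟨v, hv⟩ d
  rw [tmulW_apply, tmulW_apply, tmulW_apply, ← units_smul_eq_sgn]
  exact this

namespace DualBases

variable {Q} {n : Type*} [Fintype n] (E : Q.DualBases n)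

theorem sum_bracket_dual : ∑ a, Q.bracket (E.dual a) (E.e a) = 0 := by
  have h : ∑ a, Q.bracket (E.dual a) (E.e a) = -∑ a, Q.bracket (E.dual a) (E.e a) := by
    conv_lhs => rw [E.sum_flip (fun x y => Q.bracket x y)]
    rw [← Finset.sum_neg_distrib]
    refine Finset.sum_congr rfl fun a _ => ?_
    rw [Q.skew_sgn (E.e_mem a) (E.dual_mem a)]
    rcases zmod_two_cases (E.p a) with hp | hp <;> simp [hp]
  rw [eq_neg_iff_add_eq_zero, ← two_smul ℂ] at h
  exact (smul_eq_zero.1 h).resolve_left two_ne_zero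

/-- The linear part `∑ e^a ⊗ e_a` of the cubic Dirac operator. -/
def linearDirac : Q.W := ∑ a, Q.tmulW (Q.ιU (E.dual a)) (Q.ιCl (E.e a))

/-- Adding the double sum to its transpose leaves the commutators of `U(g)` and the contractions of
`Cl(g)`. The contractions give `2 Ω`; their own commutator correction is `∑ [e^a, e_a] = 0`. -/
theorem linearDirac_mul_linearDirac : E.linearDirac * E.linearDirac =
    Q.tmulW (Q.casimir E) 1 - (1 / 2 : ℂ) • ∑ a, Q.tmulW (Q.ιU (E.dual a)) (E.moment (E.e a)) := by
  set f : n → n → Q.W := fun a b => sgn (E.p a * E.p b) •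
    Q.tmulW (Q.ιU (E.dual a) * Q.ιU (E.dual b)) (Q.ιCl (E.e a) * Q.ιCl (E.e b)) with hf
  have h1 : E.linearDirac * E.linearDirac = ∑ a, ∑ b, f a b := by
    rw [linearDirac, Finset.sum_mul_sum]
    refine Finset.sum_congr rfl fun a _ => Finset.sum_congr rfl fun b _ => ?_
    rw [Q.tmulW_mul (Q.ιCl_mem_gradingCl (E.e_mem a)) (Q.ιU_mem_gradingU (E.dual_mem b))]
  have h2 (a b) : f b a = -f a b + sgn (E.p a * E.p b) •
      Q.tmulW (Q.ιU (Q.bracket (E.dual a) (E.dual b))) (Q.ιCl (E.e a) * Q.ιCl (E.e b)) +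
      (2 : ℂ) • (Q.tmulW (Q.ιU (E.dual a) * Q.ιU (Q.form (E.e b) (E.e a) • E.dual b)) 1
        - Q.tmulW (Q.ιU (Q.bracket (E.dual a) (Q.form (E.e b) (E.e a) • E.dual b))) 1) := by
    have hU := Q.ιU_mul_ιU (E.dual_mem a) (E.dual_mem b)
    rw [units_smul_eq_sgn] at hU
    have hC := Q.ιCl_mul_sgn (E.e_mem b) (E.e_mem a)
    have hB := Q.supersymmetric (E.e_mem a) (E.e_mem b)
    rw [units_smul_eq_sgn, smul_eq_mul] at hB
    simp only [hf]
    have hU' : Q.ιU (E.dual b) * Q.ιU (E.dual a) = sgn (E.p a * E.p b) •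
        (Q.ιU (E.dual a) * Q.ιU (E.dual b) - Q.ιU (Q.bracket (E.dual a) (E.dual b))) := by
      rw [hU, add_sub_cancel_right, smul_smul, sgn_mul_self, one_smul]
    rw [hU', hC, mul_comm (E.p b)]
    simp only [map_smul, map_add, map_sub, map_neg, LinearMap.smul_apply, LinearMap.sub_apply,
      mul_smul_comm]
    rcases zmod_two_cases (E.p a * E.p b) with hs | hs <;> rw [hs] <;>
      simp only [sgn_zero, sgn_one] <;> module
  have h3 : E.linearDirac * E.linearDirac = -(E.linearDirac * E.linearDirac) +
      ∑ a, ∑ b, sgn (E.p a * E.p b) •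
      Q.tmulW (Q.ιU (Q.bracket (E.dual a) (E.dual b))) (Q.ιCl (E.e a) * Q.ιCl (E.e b)) +
      (2 : ℂ) • Q.tmulW (Q.casimir E) 1 := by
    have h4 : E.linearDirac * E.linearDirac = ∑ a, ∑ b, f b a := by
      rw [h1, Finset.sum_comm]
    have h6 (a) : ∑ b, (Q.tmulW (Q.ιU (E.dual a) * Q.ιU (Q.form (E.e b) (E.e a) • E.dual b)) 1
        - Q.tmulW (Q.ιU (Q.bracket (E.dual a) (Q.form (E.e b) (E.e a) • E.dual b))) 1) =
        Q.tmulW (Q.ιU (E.dual a) * Q.ιU (E.e a)) 1 -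
          Q.tmulW (Q.ιU (Q.bracket (E.dual a) (E.e a))) 1 := by
      conv_rhs => rw [E.eq_sum_form_e (E.e a)]
      rw [Finset.sum_sub_distrib]
      congr 1 <;> simp [Finset.mul_sum]
    conv_lhs => rw [h4]
    rw [Finset.sum_congr rfl fun a _ => Finset.sum_congr rfl fun b _ => h2 a b]
    simp only [Finset.sum_add_distrib, Finset.sum_neg_distrib, ← Finset.smul_sum, h6]
    rw [← h1, Finset.sum_sub_distrib]
    have h7 : ∑ a, Q.tmulW (Q.ιU (Q.bracket (E.dual a) (E.e a))) 1 = 0 := by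
      rw [← LinearMap.sum_apply, ← map_sum, ← map_sum, E.sum_bracket_dual]
      simp
    rw [h7, sub_zero, casimir, map_sum, LinearMap.sum_apply]
  -- Invariance of the canonical tensor carries the bracket from the `U(g)` factor to the `Cl(g)`
  -- factor, where it forms `μ`.
  have h5 : ∑ a, ∑ b, sgn (E.p a * E.p b) •
      Q.tmulW (Q.ιU (Q.bracket (E.dual a) (E.dual b))) (Q.ιCl (E.e a) * Q.ιCl (E.e b)) =
      -∑ a, Q.tmulW (Q.ιU (E.dual a)) (E.moment (E.e a)) := by
    simp only [moment_apply', map_sum]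
    rw [Finset.sum_comm]
    conv_rhs => rw [Finset.sum_comm]
    rw [← Finset.sum_neg_distrib]
    refine Finset.sum_congr rfl fun b _ => ?_
    rw [← E.sum_bracket (fun x y => Q.tmulW (Q.ιU x) (Q.ιCl y * Q.ιCl (E.e b))) (E.dual b),
      ← Finset.sum_neg_distrib]
    refine Finset.sum_congr rfl fun a _ => ?_
    rw [Q.skew_sgn (E.dual_mem b) (E.dual_mem a), mul_comm (E.p b)]
    simp
  rw [h5] at h3
  rw [eq_comm, ← sub_eq_zero] at h3 ⊢
  refine (smul_eq_zero.1 ?_).resolve_left (two_ne_zero (α := ℂ))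
  rw [← h3]
  module

theorem dirac_sq : Q.dirac E ^ 2 = GradedTensorProduct.tmul ℂ (Q.casimir E) 1 +
    ((1 / 24 : ℂ) * Q.str (Q.adU (Q.casimir E))) • GradedTensorProduct.tmul ℂ 1 1 := by
  have h0 : Q.cubic E ∈ Q.gradingCl 0 := by
    rw [mem_parityGrading_zero, cubic_eq, map_smul, parityCl_cubicSum]
  have h1 : (1 : Q.U) ∈ Q.gradingU 0 := by rw [mem_parityGrading_zero, map_one]
  have hd : Q.dirac E = E.linearDirac + Q.tmulW 1 (Q.cubic E) := rfl
  have hx : Q.tmulW 1 (Q.cubic E) * Q.tmulW 1 (Q.cubic E) =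
      ((1 / 24 : ℂ) * Q.str (Q.adU (Q.casimir E))) • Q.tmulW 1 1 := by
    rw [Q.tmulW_mul h0 h1, E.cubic_eq, smul_mul_smul_comm, E.cubicSum_mul_cubicSum]
    simp only [mul_zero, sgn_zero, one_mul, map_smul, smul_smul]
    congr 1
    ring
  -- As `φ'` is even, the cross terms are `e^a ⊗ (e_a φ' + φ' e_a)`, and the coefficient is `6 /
  -- 12`.
  have hc : E.linearDirac * Q.tmulW 1 (Q.cubic E) + Q.tmulW 1 (Q.cubic E) * E.linearDirac =
      (1 / 2 : ℂ) • ∑ a, Q.tmulW (Q.ιU (E.dual a)) (E.moment (E.e a)) := by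
    rw [linearDirac, Finset.sum_mul, Finset.mul_sum, ← Finset.sum_add_distrib, Finset.smul_sum]
    refine Finset.sum_congr rfl fun a _ => ?_
    rw [Q.tmulW_mul (Q.ιCl_mem_gradingCl (E.e_mem a)) h1,
      Q.tmulW_mul h0 (Q.ιU_mem_gradingU (E.dual_mem a)), mul_zero, zero_mul, sgn_zero, one_smul,
      one_smul, mul_one, one_mul, ← map_add, cubic_eq, mul_smul_comm, smul_mul_assoc,
      E.ιCl_mul_cubicSum, ← smul_add, neg_add_cancel_comm, smul_smul, map_smul]
    norm_num
  rw [pow_two, hd, add_mul, mul_add, mul_add, ← add_assoc, add_assoc (_ * _), hc, hx,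
    E.linearDirac_mul_linearDirac, sub_add_cancel]
  rfl

end DualBases

end QuadraticLieSuperalgebra

/-! ### Contractions of the Cartan cubic form -/

namespace LieSuperalgebra

variable {g : Type*} [AddCommGroup g] [Module ℂ g] (L : LieSuperalgebra g)

/-- A linear operator that preserves the even and the odd part. -/
def IsEvenMap (X : g →ₗ[ℂ] g) : Prop := ∀ i, ∀ x ∈ L.part i, X x ∈ L.part i

variable {L}

theorem IsEvenMap.parity {X : g →ₗ[ℂ] g} (hX : L.IsEvenMap X) (x : g) :
    X (L.parity x) = L.parity (X x) := by
  have : X ∘ₗ L.parity = L.parity ∘ₗ X := by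
    apply L.hom_ext
    intro j x hx
    simp [L.parity_eq hx, L.parity_eq (hX j x hx)]
  exact DFunLike.congr_fun this x

end LieSuperalgebra

namespace QuadraticLieSuperalgebra

variable {g : Type*} [AddCommGroup g] [Module ℂ g] {Q : QuadraticLieSuperalgebra g}

namespace DualBases

variable {n : Type*} [Fintype n] (E : Q.DualBases n)

/-- The norm of the Cartan cubic form, with operators inserted in its three arguments. -/
def tri (X Y Z : g →ₗ[ℂ] g) : ℂ :=
  ∑ a, ∑ b, Q.form (Q.bracket (X (E.dual a)) (Y (E.dual b))) (Z (Q.bracket (E.e b) (E.e a)))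

theorem tri_add_left (X X' Y Z : g →ₗ[ℂ] g) : E.tri (X + X') Y Z = E.tri X Y Z + E.tri X' Y Z := by
  simp [tri, Finset.sum_add_distrib]

theorem tri_add_mid (X Y Y' Z : g →ₗ[ℂ] g) : E.tri X (Y + Y') Z = E.tri X Y Z + E.tri X Y' Z := by
  simp [tri, Finset.sum_add_distrib]

theorem tri_add_right (X Y Z Z' : g →ₗ[ℂ] g) :
    E.tri X Y (Z + Z') = E.tri X Y Z + E.tri X Y Z' := by
  simp [tri, Finset.sum_add_distrib]

theorem tri_eq_sum (X Y Z : g →ₗ[ℂ] g) : E.tri X Y Z = ∑ a, ∑ b, ∑ c,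
    Q.form (Q.bracket (X (E.dual a)) (Y (E.dual b))) (Z (E.dual c)) *
      Q.form (E.e c) (Q.bracket (E.e b) (E.e a)) := by
  refine Finset.sum_congr rfl fun a _ => Finset.sum_congr rfl fun b _ => ?_
  conv_lhs => rw [E.eq_sum_form_e (Q.bracket (E.e b) (E.e a))]
  simp [mul_comm]

theorem tri_eq_zero {X Y Z : g →ₗ[ℂ] g} (h : ∀ x y z, Q.form (Q.bracket (X x) (Y y)) (Z z) = 0) :
    E.tri X Y Z = 0 := by
  simp [tri, h]

/-- Both brackets are reversed, and for even operators their signs cancel. -/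
theorem tri_swap {X Y : g →ₗ[ℂ] g} (hX : Q.IsEvenMap X) (hY : Q.IsEvenMap Y) (Z : g →ₗ[ℂ] g) :
    E.tri X Y Z = E.tri Y X Z := by
  rw [tri, tri, Finset.sum_comm]
  refine Finset.sum_congr rfl fun b _ => Finset.sum_congr rfl fun a _ => ?_
  rw [Q.skew_sgn (hX _ _ (E.dual_mem a)) (hY _ _ (E.dual_mem b)),
    Q.skew_sgn (E.e_mem b) (E.e_mem a), mul_comm (E.p b)]
  rcases zmod_two_cases (E.p a * E.p b) with hp | hp <;> simp [hp]

/-- Cyclicity of `B([x, y], z)`, applied to both copies of the form; the sum over `a` is then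
evaluated in place of the one over `c`. -/
theorem tri_cycle {X : g →ₗ[ℂ] g} (hX : Q.IsEvenMap X) (Y Z : g →ₗ[ℂ] g) :
    E.tri X Y Z = E.tri Y Z X := by
  rw [tri_eq_sum, Finset.sum_comm]
  refine Finset.sum_congr rfl fun b _ => ?_
  rw [Finset.sum_comm]
  refine Finset.sum_congr rfl fun c _ => ?_
  have h (a) : Q.form (Q.bracket (X (E.dual a)) (Y (E.dual b))) (Z (E.dual c)) *
      Q.form (E.e c) (Q.bracket (E.e b) (E.e a)) =
      Q.form (X (Q.form (E.e a) (Q.parity (Q.bracket (E.e c) (E.e b))) • E.dual a))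
        (Q.bracket (Y (E.dual b)) (Z (E.dual c))) := by
    rw [Q.invariant, ← Q.invariant (E.e c), Q.form_symm _ (E.e a), ← Q.twist_one,
      Q.form_twist_left]
    simp [mul_comm]
  simp only [h]
  rw [← LinearMap.sum_apply, ← map_sum, ← map_sum, ← E.eq_sum_form_e, hX.parity,
    ← Q.form_symm]

/-- All three operators move to the other copy of the cubic form, where they become their adjoints;
two flips of the canonical tensor then exchange the copies. -/
theorem tri_adjoint {X X' Y Y' Z Z' : g →ₗ[ℂ] g} (hX : Q.IsEvenMap X) (hY : Q.IsEvenMap Y)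
    (hZ : Q.IsEvenMap Z) (hXX : ∀ x y, Q.form (X x) y = Q.form x (X' y))
    (hYY : ∀ x y, Q.form (Y x) y = Q.form x (Y' y))
    (hZZ : ∀ x y, Q.form (Z x) y = Q.form x (Z' y)) : E.tri X' Y' Z' = E.tri X Y Z := by
  rw [E.tri_swap hX hY, tri, tri]
  have h1 (a) : ∑ b, Q.form (Q.bracket (X' (E.dual a)) (Y' (E.dual b)))
      (Z' (Q.bracket (E.e b) (E.e a))) =
      ∑ b, Q.form (Q.bracket (X' (E.dual a)) (E.dual b)) (Z' (Q.bracket (Y (E.e b)) (E.e a))) :=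
    E.sum_adjoint (fun x y => Q.form (Q.bracket (X' (E.dual a)) x) (Z' (Q.bracket y (E.e a)))) hYY
  have h2 (b) : ∑ a, Q.form (Q.bracket (X' (E.dual a)) (E.dual b))
      (Z' (Q.bracket (Y (E.e b)) (E.e a))) =
      ∑ a, Q.form (Q.bracket (E.dual a) (E.dual b)) (Z' (Q.bracket (Y (E.e b)) (X (E.e a)))) :=
    E.sum_adjoint (fun x y => Q.form (Q.bracket x (E.dual b)) (Z' (Q.bracket (Y (E.e b)) y))) hXX
  have h3 (b) : ∑ a, Q.form (Q.bracket (E.dual a) (E.dual b))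
        (Z' (Q.bracket (Y (E.e b)) (X (E.e a)))) =
      ∑ a, sgn (E.p a) • Q.form (Q.bracket (E.e a) (E.dual b))
        (Z' (Q.bracket (Y (E.e b)) (X (E.dual a)))) :=
    E.sum_flip (fun x y => Q.form (Q.bracket x (E.dual b)) (Z' (Q.bracket (Y (E.e b)) (X y))))
  have h4 (a) : ∑ b, Q.form (Q.bracket (E.e a) (E.dual b))
        (Z' (Q.bracket (Y (E.e b)) (X (E.dual a)))) =
      ∑ b, sgn (E.p b) • Q.form (Q.bracket (E.e a) (E.e b))
        (Z' (Q.bracket (Y (E.dual b)) (X (E.dual a)))) :=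
    E.sum_flip (fun x y => Q.form (Q.bracket (E.e a) x) (Z' (Q.bracket (Y y) (X (E.dual a)))))
  simp only [h1]
  rw [Finset.sum_comm]
  simp only [h2, h3]
  rw [Finset.sum_comm]
  simp only [← Finset.smul_sum, h4]
  rw [Finset.sum_comm]
  simp only [Finset.smul_sum]
  rw [Finset.sum_comm]
  conv_rhs => rw [Finset.sum_comm]
  refine Finset.sum_congr rfl fun a _ => Finset.sum_congr rfl fun b _ => ?_
  rw [← hZZ, Q.form_symm_left (hZ _ _ (Q.bracket_mem (E.e_mem b) (E.e_mem a))), sgn_add]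
  rcases zmod_two_cases (E.p a) with hp | hp <;> rcases zmod_two_cases (E.p b) with hq | hq <;>
    simp [hp, hq]

theorem tri_id : E.tri LinearMap.id LinearMap.id LinearMap.id = Q.str (Q.adU (Q.casimir E)) := by
  rw [E.str_eq_sum, E.adU_casimir, tri]
  refine Finset.sum_congr rfl fun a _ => ?_
  rw [E.casimirAd_apply, map_sum]
  refine Finset.sum_congr rfl fun b _ => ?_
  rw [← Q.invariant]
  rfl

/-- By the symmetries of `tri` and adjointness, the surviving terms are six copies of `u = tri P P
N` and six of `v = tri P N O`. On the right, `tri P N id = 2u + v` and `tri P P id = u`. -/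
theorem tri_decomposition {P O N : g →ₗ[ℂ] g} (hP : Q.IsEvenMap P) (hO : Q.IsEvenMap O)
    (hN : Q.IsEvenMap N) (hPN : ∀ x y, Q.form (P x) y = Q.form x (N y))
    (hNP : ∀ x y, Q.form (N x) y = Q.form x (P y))
    (hOO : ∀ x y, Q.form (O x) y = Q.form x (O y)) (hid : P + O + N = LinearMap.id)
    (h1 : E.tri P P P = 0) (h2 : E.tri P P O = 0) (h3 : E.tri O O P = 0)
    (h4 : E.tri O O O = 0) :
    E.tri LinearMap.id LinearMap.id LinearMap.id =
      6 * (E.tri P N LinearMap.id - E.tri P P LinearMap.id) := by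
  have n1 : E.tri N N N = 0 := by rw [E.tri_adjoint hP hP hP hPN hPN hPN, h1]
  have n2 : E.tri N N O = 0 := by rw [E.tri_adjoint hP hP hO hPN hPN hOO, h2]
  have n3 : E.tri O O N = 0 := by rw [E.tri_adjoint hO hO hP hOO hOO hPN, h3]
  have n4 : E.tri N N P = E.tri P P N := E.tri_adjoint hP hP hN hPN hPN hNP
  have c1 : E.tri O P P = 0 := by rw [E.tri_cycle hO, h2]
  have c2 : E.tri P O P = 0 := by rw [E.tri_cycle hP, c1]
  have c3 : E.tri P O O = 0 := by rw [E.tri_cycle hP, h3]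
  have c4 : E.tri O P O = 0 := by rw [E.tri_cycle hO, c3]
  have c5 : E.tri O N N = 0 := by rw [E.tri_cycle hO, n2]
  have c6 : E.tri N O N = 0 := by rw [E.tri_cycle hN, c5]
  have c7 : E.tri N O O = 0 := by rw [E.tri_cycle hN, n3]
  have c8 : E.tri O N O = 0 := by rw [E.tri_cycle hO, c7]
  have c9 : E.tri N P P = E.tri P P N := E.tri_cycle hN _ _
  have c10 : E.tri P N P = E.tri P P N := by rw [E.tri_cycle hP, c9]
  have c11 : E.tri P N N = E.tri P P N := by rw [E.tri_cycle hP, n4]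
  have c12 : E.tri N P N = E.tri P P N := by rw [E.tri_cycle hN, c11]
  have c13 : E.tri O P N = E.tri P N O := E.tri_cycle hO _ _
  have c14 : E.tri N O P = E.tri P N O := by rw [E.tri_cycle hN, c13]
  have c15 : E.tri N P O = E.tri P N O := E.tri_swap hN hP O
  have c16 : E.tri O N P = E.tri P N O := by rw [E.tri_cycle hO, c15]
  have c17 : E.tri P O N = E.tri P N O := by rw [E.tri_cycle hP, c16]
  rw [← hid]
  simp only [tri_add_left, tri_add_mid, tri_add_right, h1, h2, h3, h4, n1, n2, n3, n4, c1, c2, c3,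
    c4, c5, c6, c7, c8, c9, c10, c11, c12, c13, c14, c15, c16, c17]
  ring

/-- The contraction `∑ [X e^a, e_a]`. -/
def contraction (X : g →ₗ[ℂ] g) : g := ∑ a, Q.bracket (X (E.dual a)) (E.e a)

theorem contraction_mem {X : g →ₗ[ℂ] g} (hX : Q.IsEvenMap X) : E.contraction X ∈ Q.part 0 := by
  refine Submodule.sum_mem _ fun a _ => ?_
  have := Q.bracket_mem (hX _ _ (E.dual_mem a)) (E.e_mem a)
  rwa [CharTwo.add_self_eq_zero] at this

/-- By Jacobi, `ad H` acts as a derivation on the bracket and commutes with `X`; invariance of the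
canonical tensor makes the two terms cancel. -/
theorem bracket_contraction {X : g →ₗ[ℂ] g} (hX' : Q.IsEvenMap X) {H : g} (hH : H ∈ Q.part 0)
    (hX : ∀ x, X (Q.bracket H x) = Q.bracket H (X x)) : Q.bracket H (E.contraction X) = 0 := by
  have h1 : ∑ a, Q.bracket (X (Q.bracket H (E.dual a))) (E.e a) =
      ∑ a, Q.bracket (X (E.dual a)) (Q.bracket (E.e a) H) :=
    E.sum_bracket (fun x y => Q.bracket (X x) y) H
  rw [contraction, map_sum]
  have h2 (a) : Q.bracket H (Q.bracket (X (E.dual a)) (E.e a)) =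
      Q.bracket (X (Q.bracket H (E.dual a))) (E.e a) -
        Q.bracket (X (E.dual a)) (Q.bracket (E.e a) H) := by
    rw [Q.jacobi_sgn hH (hX' _ _ (E.dual_mem a)), hX, Q.skew_sgn (E.e_mem a) hH]
    simp
  simp only [h2, Finset.sum_sub_distrib, h1, sub_self]

theorem form_contraction_left (X : g →ₗ[ℂ] g) (H : g) :
    Q.form (E.contraction X) H = Q.str (X ∘ₗ Q.bracket H) := by
  rw [contraction, map_sum, LinearMap.sum_apply, E.str_eq_sum]
  simp only [Q.invariant]
  rw [← E.sum_bracket (fun x y => Q.form (X x) y),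
    E.sum_flip (fun x y => Q.form (X (Q.bracket H x)) y)]
  refine Finset.sum_congr rfl fun a _ => ?_
  rw [Q.form_symm_left (E.dual_mem a)]
  rfl

/-- Invariance and Jacobi split each pairing in two. One part is already a summand of `tri X X id`;
in the other a flip followed by the adjoint of `X` produces `tri X X' id`. -/
theorem form_contraction_self {X X' : g →ₗ[ℂ] g} (hX : Q.IsEvenMap X)
    (hXX : ∀ x y, Q.form (X x) y = Q.form x (X' y)) :
    Q.form (E.contraction X) (E.contraction X) =
      E.tri X X' LinearMap.id - E.tri X X LinearMap.id := by
  have h1 (a b) : Q.form (Q.bracket (X (E.dual a)) (E.e a)) (Q.bracket (X (E.dual b)) (E.e b)) =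
      sgn (E.p b) • Q.form (Q.bracket (X (E.dual a)) (E.e b)) (Q.bracket (X (E.dual b)) (E.e a)) -
        Q.form (Q.bracket (X (E.dual a)) (X (E.dual b))) (Q.bracket (E.e b) (E.e a)) := by
    have hb := hX _ _ (E.dual_mem b)
    rw [Q.invariant, Q.jacobi_sgn (E.e_mem a) hb,
      Q.skew_sgn (Q.bracket_mem (E.e_mem a) hb) (E.e_mem b), Q.skew_sgn (E.e_mem a) hb,
      Q.skew_sgn (E.e_mem b) (E.e_mem a), Q.invariant, Q.invariant]
    rcases zmod_two_cases (E.p a) with hp | hp <;> rcases zmod_two_cases (E.p b) with hq | hq <;>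
      simp [hp, hq, zmod_two_one_add_one, sub_eq_add_neg]
  have h2 (a) : ∑ b, sgn (E.p b) • Q.form (Q.bracket (X (E.dual a)) (E.e b))
      (Q.bracket (X (E.dual b)) (E.e a)) =
      ∑ b, Q.form (Q.bracket (X (E.dual a)) (X' (E.dual b))) (Q.bracket (E.e b) (E.e a)) :=
    (E.sum_flip (fun x y => Q.form (Q.bracket (X (E.dual a)) x)
      (Q.bracket (X y) (E.e a)))).symm.trans
      (E.sum_adjoint (fun x y => Q.form (Q.bracket (X (E.dual a)) x)
        (Q.bracket y (E.e a))) hXX).symm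
  have h3 : Q.form (E.contraction X) (E.contraction X) = ∑ a, ∑ b,
      Q.form (Q.bracket (X (E.dual a)) (E.e a)) (Q.bracket (X (E.dual b)) (E.e b)) := by
    simp only [contraction, map_sum, LinearMap.sum_apply]
    exact Finset.sum_comm
  rw [h3]
  simp only [h1, Finset.sum_sub_distrib, h2]
  rfl

end DualBases

end QuadraticLieSuperalgebra

/-! ### Root decomposition and operators acting by scalars on root spaces -/

namespace LieSuperalgebra

variable {g : Type*} [AddCommGroup g] [Module ℂ g] {L : LieSuperalgebra g} {h : Submodule ℂ g}

theorem bracket_mem_rootSpace (hh : h ≤ L.part 0) {α β : Module.Dual ℂ h} {x y : g}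
    (hx : x ∈ L.rootSpace h α) (hy : y ∈ L.rootSpace h β) :
    L.bracket x y ∈ L.rootSpace h (α + β) := by
  intro H
  have hj : ∀ x, L.bracket H (L.bracket x y) =
      L.bracket (L.bracket H x) y + L.bracket x (L.bracket H y) := by
    intro x
    have : L.bracket H ∘ₗ L.bracket.flip y =
        L.bracket.flip y ∘ₗ L.bracket H + L.bracket.flip (L.bracket H y) := by
      apply L.hom_ext
      intro j x hx
      simp [L.jacobi_sgn (hh H.2) hx]
    exact DFunLike.congr_fun this x
  rw [hj, hx H, hy H]
  simp [add_smul]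

theorem parity_mem_rootSpace (hh : h ≤ L.part 0) {α : Module.Dual ℂ h} {x : g}
    (hx : x ∈ L.rootSpace h α) : L.parity x ∈ L.rootSpace h α := by
  intro H
  have h1 := L.twist_bracket 1 H x
  have h2 : L.parity H = (H : g) := by simp [L.parity_eq (hh H.2)]
  simp only [twist_one, h2] at h1
  rw [← h1, hx H, map_smul]

variable [FiniteDimensional ℂ g]

theorem IsCartan.iSup_rootSpace (hC : L.IsCartan h) : ⨆ α, L.rootSpace h α = ⊤ := by
  have hs (H : h) : Module.End.IsFinitelySemisimple (L.bracket H) :=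
    (hC.semisimple H H.2).isFinitelySemisimple
  have h1 := Module.End.iSup_iInf_maxGenEigenspace_eq_top_of_iSup_maxGenEigenspace_eq_top_of_commute
    (fun H : h => (L.bracket H : Module.End ℂ g)) (by
      intro H H' _
      ext x
      have := L.jacobi_sgn (hC.le_even H.2) (hC.le_even H'.2) x
      rw [hC.abelian H H.2 H' H'.2] at this
      simpa using this) (fun H => Module.End.iSup_maxGenEigenspace_eq_top _)
  rw [eq_top_iff, ← h1]
  refine iSup_le fun χ => ?_
  simp only [(hs _).maxGenEigenspace_eq_eigenspace]
  intro v hv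
  simp only [Submodule.mem_iInf, Module.End.mem_eigenspace_iff] at hv
  by_cases h0 : v = 0
  · rw [h0]; exact zero_mem _
  -- A nonzero joint eigenvector forces its eigenvalue function to be linear in `H`.
  let α : Module.Dual ℂ h :=
    { toFun := χ
      map_add' := by
        intro H H'
        apply smul_left_injective ℂ h0
        simp only [add_smul]
        rw [← hv, ← hv, ← hv]
        simp
      map_smul' := by
        intro c H
        apply smul_left_injective ℂ h0
        simp only [smul_eq_mul, mul_smul, RingHom.id_apply]
        rw [← hv, ← hv]
        simp }
  exact Submodule.mem_iSup_of_mem α fun H => hv H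

omit [FiniteDimensional ℂ g] in
theorem IsCartan.iSupIndep_rootSpace (hC : L.IsCartan h) : iSupIndep (L.rootSpace h) := by
  have h1 := Module.End.independent_iInf_maxGenEigenspace_of_forall_mapsTo
    (fun H : h => (L.bracket H : Module.End ℂ g)) (by
      intro H H' c
      apply Module.End.mapsTo_maxGenEigenspace_of_comm
      ext x
      have := L.jacobi_sgn (hC.le_even H.2) (hC.le_even H'.2) x
      rw [hC.abelian H H.2 H' H'.2] at this
      simpa using this.symm)
  refine (h1.comp (f := fun α : Module.Dual ℂ h => (α : h → ℂ)) DFunLike.coe_injective).mono ?_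
  intro α x hx
  simp only [Function.comp_apply, Submodule.mem_iInf]
  intro H
  exact Module.End.mem_maxGenEigenspace _ _ _ |>.2 ⟨1, by simp [hx H]⟩

theorem IsCartan.hom_ext (hC : L.IsCartan h) {M : Type*} [AddCommGroup M] [Module ℂ M]
    {f₁ f₂ : g →ₗ[ℂ] M} (hf : ∀ α, ∀ x ∈ L.rootSpace h α, f₁ x = f₂ x) : f₁ = f₂ := by
  rw [← sub_eq_zero, ← LinearMap.ker_eq_top, eq_top_iff, ← hC.iSup_rootSpace]
  refine iSup_le fun α x hx => ?_
  simp [hf α x hx]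

theorem IsCartan.exists_weightOp (hC : L.IsCartan h) (f : Module.Dual ℂ h → ℂ) :
    ∃ M : g →ₗ[ℂ] g, ∀ α, ∀ x ∈ L.rootSpace h α, M x = f α • x := by
  classical
  have hi := DirectSum.isInternal_submodule_of_iSupIndep_of_iSup_eq_top hC.iSupIndep_rootSpace
    hC.iSup_rootSpace
  let e := LinearEquiv.ofBijective (DirectSum.coeLinearMap (L.rootSpace h)) hi
  refine ⟨DirectSum.toModule ℂ _ g (fun α => f α • (L.rootSpace h α).subtype) ∘ₗ
    e.symm.toLinearMap, fun α x hx => ?_⟩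
  have : e.symm x = DirectSum.lof ℂ _ (fun α => L.rootSpace h α) α ⟨x, hx⟩ := by
    rw [LinearEquiv.symm_apply_eq]
    change x = DirectSum.coeLinearMap (L.rootSpace h) _
    rw [DirectSum.coeLinearMap_lof]
  simp [this]

/-- The operator that acts on the root space `g^α` by the scalar `f α`. -/
def IsCartan.weightOp (hC : L.IsCartan h) (f : Module.Dual ℂ h → ℂ) : g →ₗ[ℂ] g :=
  (hC.exists_weightOp f).choose

theorem IsCartan.weightOp_apply (hC : L.IsCartan h) (f : Module.Dual ℂ h → ℂ)
    {α : Module.Dual ℂ h} {x : g} (hx : x ∈ L.rootSpace h α) : hC.weightOp f x = f α • x :=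
  (hC.exists_weightOp f).choose_spec α x hx

theorem IsCartan.isEvenMap_weightOp (hC : L.IsCartan h) (f : Module.Dual ℂ h → ℂ) :
    L.IsEvenMap (hC.weightOp f) := by
  have h1 : L.parity ∘ₗ hC.weightOp f = hC.weightOp f ∘ₗ L.parity := by
    apply hC.hom_ext
    intro α x hx
    simp [hC.weightOp_apply f hx, hC.weightOp_apply f (parity_mem_rootSpace hC.le_even hx)]
  intro i x hx
  apply L.mem_part_of_parity
  have := DFunLike.congr_fun h1 x
  simpa [L.parity_eq hx] using this

theorem IsCartan.weightOp_bracket (hC : L.IsCartan h) (f : Module.Dual ℂ h → ℂ) (H : h) (x : g) :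
    hC.weightOp f (L.bracket H x) = L.bracket H (hC.weightOp f x) := by
  have : hC.weightOp f ∘ₗ L.bracket H = L.bracket H ∘ₗ hC.weightOp f := by
    apply hC.hom_ext
    intro α x hx
    simp [hC.weightOp_apply f hx, hx H, smul_comm (f α)]
  exact DFunLike.congr_fun this x

theorem IsCartan.weightOp_comp_bracket (hC : L.IsCartan h) (f : Module.Dual ℂ h → ℂ) (H : h) :
    hC.weightOp f ∘ₗ L.bracket H = hC.weightOp (fun α => f α * α H) := by
  apply hC.hom_ext
  intro α x hx
  simp [hC.weightOp_apply _ hx, hx H, mul_smul, smul_comm (f α)]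

/-- The trace of an operator that projects onto one root space. -/
theorem IsCartan.str_weightOp_single [DecidableEq (Module.Dual ℂ h)] (hC : L.IsCartan h)
    (α : Module.Dual ℂ h) : L.str (hC.weightOp (Pi.single α 1)) =
      Module.finrank ℂ ↥(L.rootSpace h α ⊓ L.part 0) -
        Module.finrank ℂ ↥(L.rootSpace h α ⊓ L.part 1) := by
  set M := hC.weightOp (Pi.single α 1) with hM
  have hMα (x : g) : M x ∈ L.rootSpace h α := by
    intro H
    have : L.bracket H ∘ₗ M = α H • M := by
      apply hC.hom_ext
      intro β x hx
      rw [LinearMap.comp_apply, LinearMap.smul_apply, hM, hC.weightOp_apply _ hx]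
      by_cases hβ : β = α
      · subst hβ; simp [hx H]
      · simp [hβ]
    exact DFunLike.congr_fun this x
  -- The traces of these two projections are the two dimensions, and their difference is parity
  -- composed with `M`.
  have hproj (i : ZMod 2) : LinearMap.IsProj (L.rootSpace h α ⊓ L.part i)
      ((1 / 2 : ℂ) • (M + sgn i • (L.parity ∘ₗ M))) := by
    constructor
    · intro x
      refine ⟨Submodule.smul_mem _ _ (Submodule.add_mem _ (hMα x)
        (Submodule.smul_mem _ _ (parity_mem_rootSpace hC.le_even (hMα x)))), ?_⟩
      apply L.mem_part_of_parity
      simp only [LinearMap.smul_apply, LinearMap.add_apply, LinearMap.comp_apply, map_smul,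
        map_add, L.parity_parity]
      rcases zmod_two_cases i with rfl | rfl <;> simp <;> module
    · rintro x ⟨hx, hx'⟩
      simp only [LinearMap.smul_apply, LinearMap.add_apply, LinearMap.comp_apply, hM,
        hC.weightOp_apply _ hx, L.parity_eq hx', Pi.single_eq_same, one_smul]
      rw [smul_smul, sgn_mul_self]
      module
  rw [← (hproj 0).trace, ← (hproj 1).trace, str, ← map_sub]
  congr 1
  simp
  module

/-- The supertrace is the sum of `α(H)` over `P`, weighted by superdimensions; the factor 2 offsets
the half in `ρ`. -/
theorem IsCartan.str_weightOp [DecidableEq (Module.Dual ℂ h)] (hC : L.IsCartan h)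
    (P : Finset (Module.Dual ℂ h)) (H : h) :
    L.str (hC.weightOp (fun α => if α ∈ P then 1 else 0) ∘ₗ L.bracket H) =
      2 * L.weylVector h P H := by
  have h1 : hC.weightOp (fun α => if α ∈ P then 1 else 0) ∘ₗ L.bracket H =
      ∑ α ∈ P, α H • hC.weightOp (Pi.single α 1) := by
    rw [hC.weightOp_comp_bracket]
    apply hC.hom_ext
    intro β x hx
    simp only [LinearMap.sum_apply, LinearMap.smul_apply, hC.weightOp_apply _ hx]
    by_cases hβ : β ∈ P
    · rw [Finset.sum_eq_single β]
      · simp [hβ]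
      · intro α _ hα
        simp [Pi.single_eq_of_ne (Ne.symm hα)]
      · simp [hβ]
    · rw [Finset.sum_eq_zero]
      · simp [hβ]
      · intro α hα
        have : β ≠ α := fun h => hβ (h ▸ hα)
        simp [Pi.single_eq_of_ne this]
  have h2 : L.str (∑ α ∈ P, α H • hC.weightOp (Pi.single α 1)) =
      ∑ α ∈ P, α H * L.str (hC.weightOp (Pi.single α 1)) := by
    have h3 (T : Module.End ℂ g) :
        L.str T = (LinearMap.trace ℂ g ∘ₗ LinearMap.mulLeft ℂ (L.parity : Module.End ℂ g)) T := rfl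
    simp only [h3, map_sum, map_smul, smul_eq_mul]
  rw [h1, h2, weylVector, halfSum, halfSum]
  simp only [hC.str_weightOp_single, mul_sub, LinearMap.sub_apply,
    LinearMap.smul_apply, LinearMap.sum_apply, smul_eq_mul, nsmul_eq_mul]
  rw [Finset.sum_sub_distrib]
  simp only [mul_comm]
  ring

end LieSuperalgebra

/-! ### Weights and the invariant form; the strange formula -/

namespace LieSuperalgebra

variable {g : Type*} [AddCommGroup g] [Module ℂ g] {L : LieSuperalgebra g} {h : Submodule ℂ g}

theorem IsPositiveSystem.zero_notMem {P : Finset (Module.Dual ℂ h)}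
    (hP : L.IsPositiveSystem h P) : 0 ∉ P := fun h0 => (hP.isRoot 0 h0).1 rfl

end LieSuperalgebra

namespace QuadraticLieSuperalgebra

open LieSuperalgebra

variable {g : Type*} [AddCommGroup g] [Module ℂ g] {Q : QuadraticLieSuperalgebra g}
  {h : Submodule ℂ g}

theorem form_rootSpace (hh : h ≤ Q.part 0) {α β : Module.Dual ℂ h} {x y : g}
    (hx : x ∈ Q.rootSpace h α) (hy : y ∈ Q.rootSpace h β) (hαβ : α + β ≠ 0) :
    Q.form x y = 0 := by
  obtain ⟨H, hH⟩ : ∃ H, (α + β) H ≠ 0 := by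
    by_contra! hc
    exact hαβ (LinearMap.ext hc)
  have h1 : Q.form (Q.bracket H x) y = -Q.form x (Q.bracket H y) := by
    have : Q.bracket H x = -Q.bracket x H := by
      rw [Q.skew_twist (hh H.2), Q.twist_zero]
    rw [this, map_neg, LinearMap.neg_apply, Q.invariant]
  rw [hx H, hy H] at h1
  simp only [map_smul, LinearMap.smul_apply, smul_eq_mul] at h1
  refine (mul_eq_zero.1 ?_).resolve_left hH
  rw [LinearMap.add_apply]
  linear_combination h1

theorem exists_add_of_mem_rootSpace_zero (hC : Q.IsCartan h) {x : g}
    (hx : x ∈ Q.rootSpace h 0) : ∃ u ∈ h, ∃ v ∈ Q.rootSpace h 0, v ∈ Q.part 1 ∧ x = u + v := by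
  obtain ⟨u, hu, v, hv, rfl⟩ := Q.exists_add x
  have hp := parity_mem_rootSpace hC.le_even hx
  rw [map_add, Q.parity_eq hu, Q.parity_eq hv] at hp
  have hu' : u ∈ Q.rootSpace h 0 := by
    have := Submodule.smul_mem _ (1 / 2 : ℂ) (Submodule.add_mem _ hx hp)
    convert this using 1
    rw [sgn_zero, sgn_one]
    module
  refine ⟨u, hC.self_centralizing u hu fun H hH => ?_, v, ?_, hv, rfl⟩
  · simpa using hu' ⟨H, hH⟩
  · simpa using Submodule.sub_mem _ hx hu'

/-- The zero weight space is `h` plus an odd part, and `h` brackets it to zero. By invariance only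
three odd arguments could contribute, and these pair to zero by parity. -/
theorem form_bracket_rootSpace_zero (hC : Q.IsCartan h) {x y z : g} (hx : x ∈ Q.rootSpace h 0)
    (hy : y ∈ Q.rootSpace h 0) (hz : z ∈ Q.rootSpace h 0) : Q.form (Q.bracket x y) z = 0 := by
  have hcomm {u x : g} (hu : u ∈ h) (hx : x ∈ Q.rootSpace h 0) : Q.bracket u x = 0 := by
    simpa using hx ⟨u, hu⟩
  have hcomm' {u x : g} (hu : u ∈ h) (hx : x ∈ Q.rootSpace h 0) : Q.bracket x u = 0 := by
    have := Q.skew_twist (hC.le_even hu) x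
    rwa [hcomm hu hx, Q.twist_zero, zero_eq_neg] at this
  obtain ⟨x₀, hx₀, x₁, hx₁, hx₁', rfl⟩ := exists_add_of_mem_rootSpace_zero hC hx
  obtain ⟨y₀, hy₀, y₁, hy₁, hy₁', rfl⟩ := exists_add_of_mem_rootSpace_zero hC hy
  obtain ⟨z₀, hz₀, z₁, hz₁, hz₁', rfl⟩ := exists_add_of_mem_rootSpace_zero hC hz
  have e1 : Q.bracket (x₀ + x₁) (y₀ + y₁) = Q.bracket x₁ y₁ := by
    rw [map_add Q.bracket, LinearMap.add_apply, hcomm hx₀ hy, map_add, hcomm' hy₀ hx₁]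
    simp
  have e2 : Q.form (Q.bracket x₁ y₁) z₁ = 0 :=
    Q.form_eq_zero (Q.bracket_mem hx₁' hy₁') hz₁' (by decide)
  rw [e1, map_add, e2, add_zero, Q.invariant, hcomm' hz₀ hy₁, map_zero]

variable [FiniteDimensional ℂ g]

theorem form_weightOp (hC : Q.IsCartan h) {f f' : Module.Dual ℂ h → ℂ}
    (hf : ∀ α, f' α = f (-α)) (x y : g) :
    Q.form (hC.weightOp f x) y = Q.form x (hC.weightOp f' y) := by
  have : Q.form ∘ₗ hC.weightOp f = Q.form.compl₂ (hC.weightOp f') := by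
    apply hC.hom_ext
    intro α x hx
    apply hC.hom_ext
    intro β y hy
    simp only [LinearMap.comp_apply, LinearMap.compl₂_apply, hC.weightOp_apply _ hx,
      hC.weightOp_apply _ hy, map_smul, LinearMap.smul_apply, hf]
    by_cases hαβ : α + β = 0
    · rw [eq_neg_of_add_eq_zero_left hαβ]
    · simp [form_rootSpace hC.le_even hx hy hαβ]
  exact LinearMap.congr_fun₂ this x y

/-- Reduces the vanishing of a component of the cubic form to triples of weights with sum zero. -/
theorem form_bracket_weightOp (hC : Q.IsCartan h) {f₁ f₂ f₃ : Module.Dual ℂ h → ℂ}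
    (hf : ∀ α β, ∀ x ∈ Q.rootSpace h α, ∀ y ∈ Q.rootSpace h β, ∀ z ∈ Q.rootSpace h (-(α + β)),
      f₁ α ≠ 0 → f₂ β ≠ 0 → f₃ (-(α + β)) ≠ 0 → Q.form (Q.bracket x y) z = 0) (x y z : g) :
    Q.form (Q.bracket (hC.weightOp f₁ x) (hC.weightOp f₂ y)) (hC.weightOp f₃ z) = 0 := by
  have : (Q.bracket.compl₁₂ (hC.weightOp f₁) (hC.weightOp f₂)).compr₂
      (Q.form.compl₂ (hC.weightOp f₃)) = 0 := by
    apply hC.hom_ext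
    intro α x hx
    apply hC.hom_ext
    intro β y hy
    apply hC.hom_ext
    intro γ z hz
    simp only [LinearMap.compr₂_apply, LinearMap.compl₁₂_apply, LinearMap.compl₂_apply,
      hC.weightOp_apply _ hx, hC.weightOp_apply _ hy, hC.weightOp_apply _ hz, map_smul,
      LinearMap.smul_apply, smul_eq_mul, LinearMap.zero_apply]
    by_cases hγ : α + β + γ = 0
    · obtain rfl : γ = -(α + β) := eq_neg_of_add_eq_zero_right hγ
      by_cases h1 : f₁ α = 0
      · simp [h1]
      by_cases h2 : f₂ β = 0
      · simp [h2]
      by_cases h3 : f₃ (-(α + β)) = 0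
      · rw [h3]
        simp
      rw [hf α β x hx y hy z hz h1 h2 h3]
      simp
    · rw [form_rootSpace hC.le_even (bracket_mem_rootSpace hC.le_even hx hy) hz hγ]
      simp
  exact LinearMap.congr_fun (LinearMap.congr_fun₂ this x y) z

/-- The form of a quadratic Lie superalgebra is non-degenerate on a Cartan subalgebra. -/
theorem nondegenerate_restrict (hC : Q.IsCartan h) : (Q.form.restrict h).Nondegenerate := by
  classical
  have key (H : h) (hH : ∀ H' : h, Q.form H H' = 0) : H = 0 := by
    have h0 : (H : g) ∈ Q.rootSpace h 0 := fun H' => by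
      simpa using hC.abelian H' H'.2 H H.2
    -- `H` has weight zero, so it is orthogonal to all nonzero weights, and to the odd part of `g^0`
    -- by consistency; only `h` remains.
    have h1 : Q.form H = 0 := by
      apply hC.hom_ext
      intro α x hx
      by_cases hα : α = 0
      · subst hα
        obtain ⟨u, huh, v, -, hv, rfl⟩ := exists_add_of_mem_rootSpace_zero hC hx
        rw [map_add, hH ⟨u, huh⟩, Q.form_eq_zero (hC.le_even H.2) hv (by decide)]
        simp
      · simpa using form_rootSpace hC.le_even h0 hx (by simpa using hα)
    exact Subtype.ext (Q.nondegenerate.1 _ fun y => by rw [h1]; rfl)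
  refine ⟨fun H hH => key H hH, fun H hH => key H fun H' => ?_⟩
  rw [Q.form_symm_left (hC.le_even H.2)]
  have := hH H'
  simpa using this

/-- The strange formula `B(ρ, ρ) = (1 / 24) str(ad Ω)`. -/
theorem dualForm_weylVector {n : Type*} [Fintype n] (E : Q.DualBases n) (hC : Q.IsCartan h)
    {P : Finset (Module.Dual ℂ h)} (hP : Q.IsPositiveSystem h P) :
    Q.dualForm h (nondegenerate_restrict hC) (Q.weylVector h P) (Q.weylVector h P) =
      (1 / 24 : ℂ) * Q.str (Q.adU (Q.casimir E)) := by
  classical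
  set fP : Module.Dual ℂ h → ℂ := fun α => if α ∈ P then 1 else 0 with hfP
  set fN : Module.Dual ℂ h → ℂ := fun α => if -α ∈ P then 1 else 0 with hfN
  set fO : Module.Dual ℂ h → ℂ := fun α => if α = 0 then 1 else 0 with hfO
  have eP := hC.isEvenMap_weightOp fP
  have aPN := form_weightOp hC (f := fP) (f' := fN) (fun α => rfl)
  have aNP := form_weightOp hC (f := fN) (f' := fP) (fun α => by simp [hfP, hfN])
  have aOO := form_weightOp hC (f := fO) (f' := fO) (fun α => by simp [hfO])
  -- A weight with a nonzero root space is zero or a root, and then exactly one of the three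
  -- indicators is 1.
  have hid : hC.weightOp fP + hC.weightOp fO + hC.weightOp fN = LinearMap.id := by
    apply hC.hom_ext
    intro α x hx
    simp only [LinearMap.add_apply, hC.weightOp_apply _ hx, LinearMap.id_apply, hfP, hfN, hfO]
    by_cases hα : α = 0
    · simp [hα, hP.zero_notMem]
    by_cases hx0 : x = 0
    · simp [hx0]
    have hr : Q.IsRoot h α := ⟨hα, fun hb => hx0 (by simpa [hb] using hx)⟩
    rcases hP.mem_or_neg_mem α hr with h1 | h1
    · simp [h1, hα, hP.neg_notMem α h1]
    · have h2 : α ∉ P := by simpa using hP.neg_notMem _ h1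
      simp [h1, h2, hα]
  have hS := E.tri_decomposition eP (hC.isEvenMap_weightOp fO) (hC.isEvenMap_weightOp fN) aPN aNP
    aOO hid
    -- `PPP`: if `[x, y]` is nonzero, closure puts `α + β` in `P`, against `-(α + β) ∈ P`.
    (E.tri_eq_zero (form_bracket_weightOp hC (by
      intro α β x hx y hy z hz h1 h2 h3
      have hα : α ∈ P := by simpa [hfP] using h1
      have hβ : β ∈ P := by simpa [hfP] using h2
      have hγ : -(α + β) ∈ P := by simpa [hfP] using h3
      have hb : Q.bracket x y = 0 := by
        by_contra hne
        have hr : Q.IsRoot h (α + β) := by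
          refine ⟨fun h0 => hP.zero_notMem (by simpa [h0] using hγ), fun hb => hne ?_⟩
          simpa [hb] using bracket_mem_rootSpace hC.le_even hx hy
        exact hP.neg_notMem _ (hP.add_mem α hα β hβ hr) hγ
      simp [hb])))
    -- `PPO`: the weights would be opposite, and `P` contains no opposite pair.
    (E.tri_eq_zero (form_bracket_weightOp hC (by
      intro α β x hx y hy z hz h1 h2 h3
      have hα : α ∈ P := by simpa [hfP] using h1
      have hβ : β ∈ P := by simpa [hfP] using h2
      have hγ : -(α + β) = 0 := by simpa only [hfO, ne_eq, ite_eq_right_iff, one_ne_zero,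
        imp_false, not_not] using h3
      have : β = -α := by
        rw [neg_eq_zero] at hγ
        exact eq_neg_of_add_eq_zero_right hγ
      exact absurd (this ▸ hβ) (hP.neg_notMem α hα))))
    (E.tri_eq_zero (form_bracket_weightOp hC (by
      intro α β x hx y hy z hz h1 h2 h3
      have hα : α = 0 := by simpa [hfO] using h1
      have hβ : β = 0 := by simpa [hfO] using h2
      subst hα hβ
      simp [hfP, hP.zero_notMem] at h3)))
    (E.tri_eq_zero (form_bracket_weightOp hC (by
      intro α β x hx y hy z hz h1 h2 h3
      have hα : α = 0 := by simpa [hfO] using h1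
      have hβ : β = 0 := by simpa [hfO] using h2
      subst hα hβ
      exact form_bracket_rootSpace_zero hC hx hy (by simpa using hz))))
  rw [E.tri_id, ← E.form_contraction_self eP aPN] at hS
  set r := E.contraction (hC.weightOp fP) with hr
  -- The contraction is even and commutes with `h`, so self-centralization applies.
  have hrh : r ∈ h := hC.self_centralizing r (E.contraction_mem eP) fun H hH =>
    E.bracket_contraction eP (hC.le_even hH) (hC.weightOp_bracket fP ⟨H, hH⟩)
  set t := ((Q.form.restrict h).toDual (nondegenerate_restrict hC)).symm (Q.weylVector h P) with ht
  have ht' (H : h) : Q.form t H = Q.weylVector h P H :=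
    LinearMap.BilinForm.apply_toDual_symm_apply (hB := nondegenerate_restrict hC)
      (Q.weylVector h P) H
  have hrt : (⟨r, hrh⟩ : h) = (2 : ℂ) • t := by
    rw [← sub_eq_zero]
    apply (nondegenerate_restrict hC).1
    intro H
    have h1 : Q.form r H = 2 * Q.weylVector h P H := by
      rw [hr, E.form_contraction_left, hfP, hC.str_weightOp]
    simp [h1, ht']
  have hrt' : r = (2 : ℂ) • (t : g) := congrArg Subtype.val hrt
  -- With `r = 2t` the supertrace is `6 B(r, r) = 24 B(t, t)`.
  rw [hS, hrt']
  change Q.form t t = _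
  simp
  ring

end QuadraticLieSuperalgebra

end

theorem mainTheorem6 {g : Type*} [AddCommGroup g] [Module ℂ g] [FiniteDimensional ℂ g]
    (Q : QuadraticLieSuperalgebra g) {n : Type*} [Fintype n] (E : Q.DualBases n) :
    Q.dirac E ^ 2 =
        GradedTensorProduct.tmul ℂ (Q.casimir E) 1 +
          ((1 / 24 : ℂ) * Q.str (Q.adU (Q.casimir E))) • GradedTensorProduct.tmul ℂ 1 1 ∧
      (Q.IsBasicClassical → ∀ h : Submodule ℂ g, Q.IsCartan h →
        ∀ P : Finset (Module.Dual ℂ h), Q.IsPositiveSystem h P →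
          ∃ hh : (Q.form.restrict h).Nondegenerate,
            Q.dirac E ^ 2 =
              GradedTensorProduct.tmul ℂ (Q.casimir E) 1 +
                Q.dualForm h hh (Q.weylVector h P) (Q.weylVector h P) •
                  GradedTensorProduct.tmul ℂ 1 1) := by
  refine ⟨E.dirac_sq, fun _ h hC P hP => ⟨QuadraticLieSuperalgebra.nondegenerate_restrict hC, ?_⟩⟩
  rw [E.dirac_sq, QuadraticLieSuperalgebra.dualForm_weylVector E hC hP]
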